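/- Let $S$ be a Borel subset of a Polish space, with the induced topology and its Borel $\sigma$-field $\mathcal{B}$ (equivalently: a separable metrizable space whose Borel $\sigma$-field is standard). Let $(\Omega,\mathcal{A},P)$ be a probability space, $(X_n)_{n\ge 1}$ any sequence of $S$-valued random variables on it, $\mathcal{F}_0=\{\emptyset,\Omega\}$ and $\mathcal{F}_n=\sigma(X_1,\ldots,X_n)$ for $n\ge 1$. A random probability measure on $\mathcal{B}$ is a map $\alpha:\Omega\times\mathcal{B}\to[0,1]$ such that $\alpha(\omega,\cdot)$ is a probability measure for every $\omega\in\Omega$ and $\omega\mapsto\alpha(\omega,B)$ is $\mathcal{A}$-measurable for every $B\in\mathcal{B}$; for bounded Borel $f:S\to\mathbb{R}$ write $\alpha(f)(\omega)=\int f(x)\,\alpha(\omega,dx)$. For $n\ge 0$ let $\alpha_n(\cdot)=P(X_{n+1}\in\cdot\mid\mathcal{F}_n)$ be the predictive distribution, that is, the regular conditional distribution of $X_{n+1}$ given $\mathcal{F}_n$, so that $\alpha_n(f)=E\{f(X_{n+1})\mid\mathcal{F}_n\}$ a.s. for every bounded Borel $f$. Say that $X_n$ converges stably to a random probability measure $\alpha$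 if, for every $H\in\mathcal{A}$ with $P(H)>0$, the probability measures $P(X_n\in\cdot\mid H)$ converge weakly to $E\{\alpha(\cdot)\mid H\}$ as $n\to\infty$. **Theorem.** The following are equivalent: (a) for every bounded Borel function $f:S\to\mathbb{R}$, $\alpha_n(f)$ converges in probability, as $n\to\infty$, to some real random variable; (b) $\lim_n P(X_n\in B)$ exists for every $B\in\mathcal{B}$, and there is a random probability measure $\alpha$ on $\mathcal{B}$ such that $X_n$ converges stably to $\alpha$ and $$E\{\alpha(f)^2\}=\lim_n E\{\alpha_n(f)^2\}\quad\text{for every bounded continuous } f:S\to\mathbb{R}.$$ -/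

import Mathlib

open MeasureTheory ProbabilityTheory Filter Topology BoundedContinuousFunction

noncomputable section

namespace PredictiveConvergence

universe u v

variable {Ω : Type u} {S : Type v} [MeasurableSpace Ω] [MeasurableSpace S]

/-- The past `(X₁, …, Xₙ)` of the sequence `X₁, X₂, …`, where `Xᵢ₊₁` is written `X i`. -/
def past (X : ℕ → Ω → S) (n : ℕ) (ω : Ω) : Fin n → S := fun i => X i ω

/-- The predictive distribution `αₙ(ω, ·) = P(Xₙ₊₁ ∈ · ∣ 𝓕ₙ)(ω)`,
where `𝓕ₙ = σ(X₁, …, Xₙ)` and `𝓕₀` is trivial: the regular conditional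
distribution of `Xₙ₊₁` given `(X₁, …, Xₙ)`, evaluated at `(X₁(ω), …, Xₙ(ω))`.
Here `Xᵢ₊₁` is written `X i`, so that `Xₙ₊₁` is `X n`. -/
def predictive [StandardBorelSpace S] [Nonempty S] (P : Measure Ω) [IsProbabilityMeasure P]
    (X : ℕ → Ω → S) (n : ℕ) (ω : Ω) : Measure S :=
  condDistrib (X n) (past X n) P (past X n ω)

/-- `predictive` is a version of the conditional law: `αₙ(f) = E{f(Xₙ₊₁) ∣ 𝓕ₙ}` almost surely for
every bounded Borel `f`. -/
theorem predictive_ae_eq_condExp [StandardBorelSpace S] [Nonempty S]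
    (P : Measure Ω) [IsProbabilityMeasure P] (X : ℕ → Ω → S) (hX : ∀ n, Measurable (X n)) (n : ℕ)
    (f : S → ℝ) (hf : Measurable f) (hb : ∃ C : ℝ, ∀ x, |f x| ≤ C) :
    (fun ω => ∫ x, f x ∂(predictive P X n ω)) =ᵐ[P]
      P[fun ω => f (X n ω) | ⨆ i : Fin n, MeasurableSpace.comap (X i) inferInstance] := by
  obtain ⟨C, hC⟩ := hb
  have hpast : Measurable (past X n) := measurable_pi_lambda _ fun i => hX i
  have hσ : (⨆ i : Fin n, MeasurableSpace.comap (X i) inferInstance) =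
      MeasurableSpace.comap (past X n) MeasurableSpace.pi := by
    simp only [MeasurableSpace.pi, MeasurableSpace.comap_iSup, MeasurableSpace.comap_comp]
    rfl
  rw [hσ]
  refine (condExp_ae_eq_integral_condDistrib hpast (hX n).aemeasurable hf.stronglyMeasurable
    ?_).symm
  exact Integrable.of_bound (hf.comp (hX n)).aestronglyMeasurable C
    (ae_of_all _ fun ω => hC (X n ω))

/-- Every real bounded Borel `f` has `αₙ(f)` converging in probability (to a real random variable
which may depend on `f`). -/
def PredictiveConverges [StandardBorelSpace S] [Nonempty S]
    (P : Measure Ω) [IsProbabilityMeasure P] (X : ℕ → Ω → S) : Prop :=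
  ∀ f : S → ℝ, Measurable f → (∃ C : ℝ, ∀ x, |f x| ≤ C) →
    ∃ g : Ω → ℝ, Measurable g ∧
      TendstoInMeasure P (fun n ω => ∫ x, f x ∂(predictive P X n ω)) atTop g

/-- The conditional law `P(Y ∈ · ∣ H)`, for an event `H` of positive probability. -/
def condLaw (P : Measure Ω) [IsProbabilityMeasure P] {H : Set Ω} (hH : P H ≠ 0)
    {Y : Ω → S} (hY : Measurable Y) : ProbabilityMeasure S :=
  ⟨P[|H].map Y,
    haveI := cond_isProbabilityMeasure hH
    Measure.isProbabilityMeasure_map hY.aemeasurable⟩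

/-- The probability measure `B ↦ E{α(B) ∣ H}`, for an event `H` of positive probability and a
random probability measure `α`, that is, a Markov kernel from `Ω` to `S`. -/
def condMean (P : Measure Ω) [IsProbabilityMeasure P] {H : Set Ω} (hH : P H ≠ 0)
    (α : Kernel Ω S) [IsMarkovKernel α] : ProbabilityMeasure S :=
  ⟨P[|H].bind α,
    haveI := cond_isProbabilityMeasure hH
    isProbabilityMeasure_bind α.measurable.aemeasurable (ae_of_all _ fun _ => inferInstance)⟩

/-- `Xₙ` converges stably to the random probability measure `α`: for every event `H` of positive
probability, `P(Xₙ ∈ · ∣ H)` converges weakly to `E{α(·) ∣ H}`. -/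
def ConvergesStably [TopologicalSpace S] [OpensMeasurableSpace S]
    (P : Measure Ω) [IsProbabilityMeasure P] (X : ℕ → Ω → S) (hX : ∀ n, Measurable (X n))
    (α : Kernel Ω S) [IsMarkovKernel α] : Prop :=
  ∀ (H : Set Ω), MeasurableSet H → ∀ hH : P H ≠ 0,
    Tendsto (fun n => condLaw P hH (hX n)) atTop (𝓝 (condMean P hH α))

end PredictiveConvergence

end

/-! Write `αₙ` for the predictive distribution of `X n`, and `E α` for the mean measure `P.bind α`.

The link between the two sides is Lévy's upward theorem. For integrable `Z`, the expectations of `Z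
f(X n)` and `Z αₙ(f)` are those of `E[Z | 𝓕_∞] f(X n)` and `E[Z | 𝓕ₙ] f(X n)`, so their difference
tends to zero (`tendsto_integral_mul_sub_integral_mul_predictiveKernel`). Stable convergence of `X
n` is therefore weak convergence of `αₙ(f)` against bounded weights.

From (a), the limits of `αₙ(B)` must be assembled into one random measure. Nikodym's theorem makes
their integral over any event a measure in `B`. This yields a random distribution function on the
rationals, hence a kernel on `ℝ`, and a measurable embedding carries it back to `S`
(`exists_kernel_tendstoInMeasure`). Convergence then holds in `L¹`, and (b) follows by integration.

From (b), expand `E(αₙ(f) - α(f))²` for continuous `f`. The cross term tends to `E α(f)²` by the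
Lévy step with `Z = α(f)`, so the second moment condition gives `L²` convergence. A bounded Borel
`f` is approximated by a continuous `g` in `L¹(E α)`. The error under `αₙ` is at most `E|f - g|(X
n)`, which is controlled because the laws of `X n` converge setwise to `E α`; Nikodym's theorem is
needed again to identify that setwise limit. -/

namespace PredictiveConvergence

noncomputable section

/-! ### Setwise limits of finite measures -/

section Nikodym

variable {S : Type*} [MeasurableSpace S]

/-- The gliding hump argument: a setwise limit of finite measures is continuous from above at the
empty set. -/
theorem exists_limit_le_of_antitone (μ : ℕ → Measure S) [∀ n, IsFiniteMeasure (μ n)]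
    (l : Set S → ℝ)
    (hl : ∀ B, MeasurableSet B → Tendsto (fun n => (μ n).real B) atTop (𝓝 (l B)))
    (B : ℕ → Set S) (hB : ∀ k, MeasurableSet (B k)) (hanti : Antitone B)
    (hempty : ⋂ k, B k = ∅) {ε : ℝ} (hε : 0 < ε) : ∃ k, l (B k) ≤ ε := by
  by_contra! hcon
  have hε8 : 0 < ε / 8 := by positivity
  -- One stage of the construction: a late measure that sees a large `B k` and is already close to
  -- `l` on the set `U` built so far; then `k'` is taken so far out that this same measure nearly
  -- ignores `B k'`.
  have step : ∀ (j k : ℕ) (U : {U : Set S // MeasurableSet U}), ∃ n k' : ℕ, j ≤ n ∧ k < k' ∧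
      ε < (μ n).real (B k) ∧ |(μ n).real U.1 - l U.1| < ε / 8 ∧ (μ n).real (B k') < ε / 8 := by
    intro j k U
    have h1 := (hl (B k) (hB k)).eventually (lt_mem_nhds (hcon k))
    have h2 := (hl U.1 U.2).eventually (Metric.ball_mem_nhds _ hε8)
    obtain ⟨n, hn1, hn2, hnj⟩ := (h1.and (h2.and (eventually_ge_atTop j))).exists
    have h3 : Tendsto (fun k => (μ n).real (B k)) atTop (𝓝 0) := by
      have h := tendsto_measure_iInter_atTop (μ := μ n) (fun k => (hB k).nullMeasurableSet) hanti
        ⟨0, measure_ne_top _ _⟩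
      rw [hempty, measure_empty] at h
      exact (ENNReal.tendsto_toReal ENNReal.zero_ne_top).comp h
    obtain ⟨k', hk', hkk'⟩ :=
      ((h3.eventually (gt_mem_nhds hε8)).and (eventually_gt_atTop k)).exists
    exact ⟨n, k', hnj, hkk', hn1, by simpa [Real.dist_eq] using hn2, hk'⟩
  choose N K hjN hkK hhump hU hsmall using step
  -- The hump `B (k j) \ B (k (j + 1))` is added only at odd stages, so that the union of the humps
  -- is seen differently by the measures of odd and of even index.
  let next : ℕ → ℕ × {U : Set S // MeasurableSet U} → ℕ × {U : Set S // MeasurableSet U} :=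
    fun j s => (K j s.1 s.2,
      ⟨if Even j then s.2.1 else s.2.1 ∪ (B s.1 \ B (K j s.1 s.2)), by
        split_ifs
        · exact s.2.2
        · exact s.2.2.union ((hB _).diff (hB _))⟩)
  let s : ℕ → ℕ × {U : Set S // MeasurableSet U} :=
    fun j => Nat.rec (0, ⟨∅, MeasurableSet.empty⟩) next j
  let k : ℕ → ℕ := fun j => (s j).1
  let V : ℕ → Set S := fun j => (s j).2.1
  let n : ℕ → ℕ := fun j => N j (s j).1 (s j).2
  have hV : ∀ j, MeasurableSet (V j) := fun j => (s j).2.2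
  have hk1 : ∀ j, k j < k (j + 1) := fun j => hkK j (s j).1 (s j).2
  have hkmono : Monotone k := monotone_nat_of_le_succ fun j => (hk1 j).le
  have hVeven : ∀ j, Even j → V (j + 1) = V j := fun j hj => if_pos hj
  have hVodd : ∀ j, ¬ Even j → V (j + 1) = V j ∪ (B (k j) \ B (k (j + 1))) := fun j hj => if_neg hj
  have hVsucc : ∀ j, V j ⊆ V (j + 1) := by
    intro j
    by_cases hj : Even j
    · exact (hVeven j hj).ge
    · rw [hVodd j hj]; exact Set.subset_union_left
  have hVmono : Monotone V := monotone_nat_of_le_succ hVsucc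
  have hVsucc' : ∀ j, V (j + 1) ⊆ V j ∪ (B (k j) \ B (k (j + 1))) := by
    intro j
    by_cases hj : Even j
    · rw [hVeven j hj]; exact Set.subset_union_left
    · exact (hVodd j hj).le
  have hdisj : ∀ j, Disjoint (V j) (B (k j)) := by
    intro j
    induction j with
    | zero => exact Set.empty_disjoint _
    | succ j ih =>
      refine Disjoint.mono_left (hVsucc' j) ?_
      rw [Set.disjoint_union_left]
      exact ⟨ih.mono_right (hanti (hk1 j).le), Set.disjoint_sdiff_left⟩
  -- Whatever is added from stage `j` on lies in `B (k j)`.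
  have htail : ∀ j i, V i ⊆ V j ∪ B (k j) := by
    intro j i
    rcases le_total i j with hij | hij
    · exact (hVmono hij).trans Set.subset_union_left
    · induction i, hij using Nat.le_induction with
      | base => exact Set.subset_union_left
      | succ i hij ih =>
        refine (hVsucc' i).trans (Set.union_subset ih ?_)
        exact (Set.sdiff_subset.trans (hanti (hkmono hij))).trans Set.subset_union_right
  let A : Set S := ⋃ j, V j
  have hA : MeasurableSet A := MeasurableSet.iUnion hV
  have hAtail : ∀ j, A ⊆ V j ∪ B (k j) := fun j => Set.iUnion_subset (htail j)
  have hn : Tendsto n atTop atTop := tendsto_atTop_mono (fun j => hjN j (s j).1 (s j).2) tendsto_id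
  have hlmono : ∀ C D, MeasurableSet C → MeasurableSet D → C ⊆ D → l C ≤ l D :=
    fun C D hC hD hCD => le_of_tendsto_of_tendsto' (hl C hC) (hl D hD)
      fun n => measureReal_mono hCD
  obtain ⟨L, hL⟩ : ∃ L, Tendsto (fun j => l (V j)) atTop (𝓝 L) :=
    ⟨_, tendsto_atTop_ciSup (fun i j hij => hlmono _ _ (hV i) (hV j) (hVmono hij))
      ⟨l Set.univ, by rintro _ ⟨j, rfl⟩; exact hlmono _ _ (hV j) .univ (Set.subset_univ _)⟩⟩
  -- This sequence converges, yet it stays above `3ε/4 = ε - 2 · ε/8` at odd stages and below `ε/4 =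
  -- 2 · ε/8` at even ones.
  have hlim : Tendsto (fun j => (μ (n j)).real A - l (V j)) atTop (𝓝 (l A - L)) :=
    ((hl A hA).comp hn).sub hL
  have hodd : ∀ j, ¬ Even j → 3 / 4 * ε ≤ (μ (n j)).real A - l (V j) := by
    intro j hj
    have h1 : ε < (μ (n j)).real (B (k j)) := hhump j (s j).1 (s j).2
    have h2 : |(μ (n j)).real (V j) - l (V j)| < ε / 8 := hU j (s j).1 (s j).2
    have h3 : (μ (n j)).real (B (k (j + 1))) < ε / 8 := hsmall j (s j).1 (s j).2
    have h4 : (μ (n j)).real (V j ∪ (B (k j) \ B (k (j + 1)))) ≤ (μ (n j)).real A := by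
      rw [← hVodd j hj]; exact measureReal_mono (Set.subset_iUnion V (j + 1))
    rw [measureReal_union ((hdisj j).mono_right Set.sdiff_subset) ((hB _).diff (hB _)),
      measureReal_sdiff (hanti (hk1 j).le) (hB _)] at h4
    have := abs_lt.1 h2
    linarith
  have heven : ∀ j, Even j → (μ (n j)).real A - l (V j) ≤ 1 / 4 * ε := by
    intro j hj
    have h2 : |(μ (n j)).real (V j) - l (V j)| < ε / 8 := hU j (s j).1 (s j).2
    have h3 : (μ (n j)).real (B (k (j + 1))) < ε / 8 := hsmall j (s j).1 (s j).2
    have h4 : (μ (n j)).real A ≤ (μ (n j)).real (V j ∪ B (k (j + 1))) := by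
      rw [← hVeven j hj]; exact measureReal_mono (hAtail (j + 1))
    have h5 := measureReal_union_le (μ := μ (n j)) (V j) (B (k (j + 1)))
    have := abs_lt.1 h2
    linarith
  have h2j : Tendsto (fun j : ℕ => 2 * j) atTop atTop :=
    tendsto_id.const_mul_atTop' (by norm_num)
  have hge : 3 / 4 * ε ≤ l A - L :=
    ge_of_tendsto' (hlim.comp ((tendsto_add_atTop_nat 1).comp h2j)) fun j =>
      hodd _ (by simp)
  have hle : l A - L ≤ 1 / 4 * ε :=
    le_of_tendsto' (hlim.comp h2j) fun j => heven _ (by simp)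
  linarith

/-- **Nikodym's convergence theorem**: a setwise limit of finite measures is a finite measure. -/
theorem exists_measure_tendsto (μ : ℕ → Measure S) [∀ n, IsFiniteMeasure (μ n)]
    (h : ∀ B, MeasurableSet B → ∃ l : ℝ, Tendsto (fun n => (μ n).real B) atTop (𝓝 l)) :
    ∃ ν : Measure S, IsFiniteMeasure ν ∧
      ∀ B, MeasurableSet B → Tendsto (fun n => (μ n).real B) atTop (𝓝 (ν.real B)) := by
  classical
  let l : Set S → ℝ := fun B => if hB : MeasurableSet B then (h B hB).choose else 0
  have hl : ∀ B, MeasurableSet B → Tendsto (fun n => (μ n).real B) atTop (𝓝 (l B)) := by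
    intro B hB
    simp only [l, dif_pos hB]
    exact (h B hB).choose_spec
  have hl0 : ∀ B, MeasurableSet B → 0 ≤ l B := fun B hB =>
    ge_of_tendsto' (hl B hB) fun n => measureReal_nonneg
  have hlU : ∀ A B, MeasurableSet A → MeasurableSet B → Disjoint A B → l (A ∪ B) = l A + l B := by
    intro A B hA hB hAB
    refine tendsto_nhds_unique (hl _ (hA.union hB)) (((hl A hA).add (hl B hB)).congr fun n => ?_)
    rw [measureReal_union hAB hB]
  have hle : l ∅ = 0 := tendsto_nhds_unique (hl ∅ .empty) (by simp)
  have hlmono : ∀ C D, MeasurableSet C → MeasurableSet D → C ⊆ D → l C ≤ l D :=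
    fun C D hC hD hCD => le_of_tendsto_of_tendsto' (hl C hC) (hl D hD)
      fun n => measureReal_mono hCD
  have hsum : ∀ f : ℕ → Set S, (∀ i, MeasurableSet (f i)) → Pairwise (Function.onFun Disjoint f) →
      HasSum (fun i => l (f i)) (l (⋃ i, f i)) := by
    intro f hf hd
    rw [hasSum_iff_tendsto_nat_of_nonneg fun i => hl0 _ (hf i)]
    let T : ℕ → Set S := fun k => ⋃ i ≥ k, f i
    have hT : ∀ k, MeasurableSet (T k) := fun k =>
      MeasurableSet.iUnion fun i => MeasurableSet.iUnion fun _ => hf i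
    have hTanti : Antitone T := fun a b hab =>
      Set.biUnion_subset_biUnion_left fun i (hi : b ≤ i) => hab.trans hi
    have hTsucc : ∀ k, T k = f k ∪ T (k + 1) := by
      intro k
      ext x
      simp only [T, Set.mem_iUnion, Set.mem_union, exists_prop, ge_iff_le]
      constructor
      · rintro ⟨i, hi, hx⟩
        rcases hi.eq_or_lt with rfl | hi
        · exact Or.inl hx
        · exact Or.inr ⟨i, hi, hx⟩
      · rintro (hx | ⟨i, hi, hx⟩)
        · exact ⟨k, le_rfl, hx⟩
        · exact ⟨i, by omega, hx⟩
    have hTdisj : ∀ k, Disjoint (f k) (T (k + 1)) := by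
      intro k
      simp only [T, Set.disjoint_iUnion_right]
      exact fun i hi => hd (by omega)
    have hT0 : T 0 = ⋃ i, f i := by simp [T]
    have hTempty : ⋂ k, T k = ∅ := by
      refine Set.eq_empty_of_forall_notMem fun x hx => ?_
      have hx' : ∀ k, ∃ i ≥ k, x ∈ f i := by simpa [T] using hx
      obtain ⟨i, -, hi⟩ := hx' 0
      obtain ⟨j, hj, hj'⟩ := hx' (i + 1)
      exact Set.disjoint_left.1 (hd (by omega : i ≠ j)) hi hj'
    have hpart : ∀ k, ∑ i ∈ Finset.range k, l (f i) = l (⋃ i, f i) - l (T k) := by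
      intro k
      induction k with
      | zero => simp [hT0]
      | succ k ih =>
        rw [Finset.sum_range_succ, ih, hTsucc k, hlU _ _ (hf k) (hT _) (hTdisj k)]; ring
    -- Finite additivity passes to the limit trivially; the gliding hump supplies the vanishing of
    -- the tails, which is what countable additivity still requires.
    have hTlim : Tendsto (fun k => l (T k)) atTop (𝓝 0) := by
      rw [Metric.tendsto_atTop]
      intro ε hε
      obtain ⟨k, hk⟩ := exists_limit_le_of_antitone μ l hl T hT hTanti hTempty (half_pos hε)
      refine ⟨k, fun m hm => ?_⟩
      rw [Real.dist_0_eq_abs, abs_of_nonneg (hl0 _ (hT m))]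
      linarith [hlmono _ _ (hT m) (hT k) (hTanti hm)]
    simp_rw [hpart]
    simpa using tendsto_const_nhds.sub hTlim
  let ν : Measure S := Measure.ofMeasurable (fun B _ => ENNReal.ofReal (l B)) (by simp [hle]) (by
    intro f hf hd
    rw [← (hsum f hf hd).tsum_eq,
      ENNReal.ofReal_tsum_of_nonneg (fun i => hl0 _ (hf i)) (hsum f hf hd).summable])
  have hν : ∀ B, MeasurableSet B → ν B = ENNReal.ofReal (l B) := fun B hB =>
    Measure.ofMeasurable_apply B hB
  refine ⟨ν, ⟨by rw [hν _ .univ]; exact ENNReal.ofReal_lt_top⟩, fun B hB => ?_⟩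
  rw [Measure.real, hν B hB, ENNReal.toReal_ofReal (hl0 B hB)]
  exact hl B hB

end Nikodym

/-! ### From indicators to bounded measurable functions -/

/-- Subadditive functionals which are uniformly continuous for the sup norm and tend to zero on
multiples of indicators tend to zero on every bounded measurable function. -/
theorem tendsto_zero_of_indicator {S : Type*} [MeasurableSpace S] (L : ℕ → (S → ℝ) → ℝ) (K : ℝ)
    (hL0 : ∀ n f, 0 ≤ L n f)
    (hadd : ∀ n f g, Measurable f → (∃ C, ∀ x, |f x| ≤ C) → Measurable g → (∃ C, ∀ x, |g x| ≤ C) →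
      L n (fun x => f x + g x) ≤ L n f + L n g)
    (hbound : ∀ n f ε, Measurable f → (∀ x, |f x| ≤ ε) → L n f ≤ K * ε)
    (hind : ∀ B c, MeasurableSet B →
      Tendsto (fun n => L n (B.indicator fun _ => c)) atTop (𝓝 0))
    (f : S → ℝ) (hf : Measurable f) (hb : ∃ C, ∀ x, |f x| ≤ C) :
    Tendsto (fun n => L n f) atTop (𝓝 0) := by
  obtain ⟨C, hC⟩ := hb
  have hsimple : ∀ g : SimpleFunc S ℝ, Tendsto (fun n => L n g) atTop (𝓝 0) := by
    intro g
    induction g using SimpleFunc.induction with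
    | const c hs =>
      refine (hind _ c hs).congr fun n => congrArg (L n) ?_
      ext x
      simp [Set.indicator, Set.piecewise]
    | @add f g hd hf hg =>
      obtain ⟨Cf, hCf⟩ := f.exists_forall_norm_le
      obtain ⟨Cg, hCg⟩ := g.exists_forall_norm_le
      refine squeeze_zero (fun n => hL0 _ _)
        (fun n => hadd n f g f.measurable ⟨Cf, hCf⟩ g.measurable ⟨Cg, hCg⟩) ?_
      simpa using hf.add hg
  have hK : 0 ≤ K := by
    have := (hL0 0 _).trans (hbound 0 (fun _ => 0) 1 measurable_const (by simp))
    linarith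
  rw [Metric.tendsto_atTop]
  intro ε hε
  -- Rounding `f` down to the grid of mesh `1 / N` costs at most `K / N ≤ ε / 2`; the `+ 1` keeps
  -- `N` positive when `K = 0`.
  let N : ℝ := 2 * (K + 1) / ε
  have hN : 0 < N := by positivity
  have hfloor : Measurable fun x => (⌊f x * N⌋ : ℝ) / N :=
    ((measurable_from_top (f := fun z : ℤ => (z : ℝ))).comp
      (Int.measurable_floor.comp (hf.mul_const N))).div_const N
  let g : SimpleFunc S ℝ :=
    ⟨fun x => (⌊f x * N⌋ : ℝ) / N, fun y => hfloor (measurableSet_singleton y), by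
      refine ((Set.finite_Icc ⌊-C * N⌋ ⌊C * N⌋).image fun z : ℤ => (z : ℝ) / N).subset ?_
      rintro _ ⟨x, rfl⟩
      have h := abs_le.1 (hC x)
      exact ⟨⌊f x * N⌋, ⟨Int.floor_mono (mul_le_mul_of_nonneg_right h.1 hN.le),
        Int.floor_mono (mul_le_mul_of_nonneg_right h.2 hN.le)⟩, rfl⟩⟩
  have hg : ∀ x, |f x - g x| ≤ 1 / N := by
    intro x
    have h1 : f x - g x = (f x * N - ⌊f x * N⌋) / N := by
      change f x - (⌊f x * N⌋ : ℝ) / N = _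
      field_simp
    rw [h1, abs_div, abs_of_pos hN]
    gcongr
    rw [abs_le]
    constructor <;> linarith [Int.floor_le (f x * N), Int.lt_floor_add_one (f x * N)]
  obtain ⟨n₀, hn₀⟩ := Metric.tendsto_atTop.1 (hsimple g) (ε / 2) (half_pos hε)
  refine ⟨n₀, fun n hn => ?_⟩
  have h1 := hn₀ n hn
  obtain ⟨Cg, hCg⟩ := g.exists_forall_norm_le
  rw [Real.dist_0_eq_abs, abs_of_nonneg (hL0 _ _)] at h1 ⊢
  have h2 := hadd n g (fun x => f x - g x) g.measurable ⟨Cg, hCg⟩ (hf.sub g.measurable) ⟨_, hg⟩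
  have h3 := hbound n (fun x => f x - g x) _ (hf.sub g.measurable) hg
  have h4 : K * (1 / N) ≤ ε / 2 := by
    have : K * (1 / N) = K / (K + 1) * (ε / 2) := by
      simp only [N]; field_simp
    rw [this]
    exact mul_le_of_le_one_left (by positivity) ((div_le_one (by positivity)).2 (by linarith))
  simp only [add_sub_cancel] at h2
  linarith

/-! ### Convergence in measure of bounded sequences -/

section InMeasure

variable {Ω : Type*} [MeasurableSpace Ω] {P : Measure Ω}

theorem tendstoInMeasure_const (P : Measure Ω) (c : ℝ) :
    TendstoInMeasure P (fun (_ : ℕ) (_ : Ω) => c) atTop fun _ => c := by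
  intro ε hε
  simp [hε.ne']

theorem ae_abs_le_of_tendstoInMeasure {f : ℕ → Ω → ℝ} {g : Ω → ℝ} {C : ℝ}
    (hC : ∀ n ω, |f n ω| ≤ C) (h : TendstoInMeasure P f atTop g) : ∀ᵐ ω ∂P, |g ω| ≤ C := by
  obtain ⟨ns, -, hns⟩ := h.exists_seq_tendsto_ae
  filter_upwards [hns] with ω hω
  exact le_of_tendsto' hω.abs fun n => hC _ _

theorem ae_le_of_tendstoInMeasure {f f' : ℕ → Ω → ℝ} {g g' : Ω → ℝ}
    (hff' : ∀ n ω, f n ω ≤ f' n ω) (h : TendstoInMeasure P f atTop g)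
    (h' : TendstoInMeasure P f' atTop g') : ∀ᵐ ω ∂P, g ω ≤ g' ω := by
  obtain ⟨ns, hmono, hns⟩ := h.exists_seq_tendsto_ae
  obtain ⟨ms, hms, hms'⟩ := TendstoInMeasure.exists_seq_tendsto_ae
    (h'.comp hmono.tendsto_atTop)
  filter_upwards [hns, hms'] with ω hω hω'
  exact le_of_tendsto_of_tendsto' (hω.comp hms.tendsto_atTop) hω' fun n => hff' _ _

/-- Bounded convergence in measure implies convergence in `L¹`. -/
theorem tendsto_integral_abs_sub_of_tendstoInMeasure [IsFiniteMeasure P] {f : ℕ → Ω → ℝ} {g : Ω → ℝ} {C : ℝ}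
    (hf : ∀ n, Measurable (f n)) (hg : Measurable g)
    (hC : ∀ n ω, |f n ω| ≤ C) (h : TendstoInMeasure P f atTop g) :
    Tendsto (fun n => ∫ ω, |f n ω - g ω| ∂P) atTop (𝓝 0) := by
  have hgC := ae_abs_le_of_tendstoInMeasure hC h
  refine tendsto_of_subseq_tendsto fun ns hns => ?_
  obtain ⟨ms, -, hms⟩ := TendstoInMeasure.exists_seq_tendsto_ae (h.comp hns)
  refine ⟨ms, ?_⟩
  have := tendsto_integral_of_dominated_convergence (μ := P)
    (F := fun n ω => |f (ns (ms n)) ω - g ω|) (f := fun _ => 0) (fun _ => C + C)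
    (fun n => ((hf _).sub hg).abs.aestronglyMeasurable) (integrable_const _)
    (fun n => by
      filter_upwards [hgC] with ω hω
      rw [Real.norm_eq_abs, abs_abs]
      exact (abs_sub _ _).trans (add_le_add (hC _ _) hω))
    (by
      filter_upwards [hms] with ω hω
      simpa using (hω.sub_const (g ω)).abs)
  simpa using this

theorem tendstoInMeasure_of_tendsto_integral_abs_sub {f : ℕ → Ω → ℝ} {g : Ω → ℝ}
    (hf : ∀ n, Integrable (f n) P) (hg : Integrable g P)
    (h : Tendsto (fun n => ∫ ω, |f n ω - g ω| ∂P) atTop (𝓝 0)) :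
    TendstoInMeasure P f atTop g := by
  refine tendstoInMeasure_of_tendsto_eLpNorm one_ne_zero
    (fun n => (hf n).aestronglyMeasurable) hg.aestronglyMeasurable ?_
  have h1 : ∀ n, eLpNorm (f n - g) 1 P = ENNReal.ofReal (∫ ω, |f n ω - g ω| ∂P) := by
    intro n
    rw [eLpNorm_one_eq_lintegral_enorm, ← ofReal_integral_norm_eq_lintegral_enorm ((hf n).sub hg)]
    rfl
  simp_rw [h1]
  simpa using ENNReal.tendsto_ofReal h

/-- `L¹` convergence implies convergence of the integrals against a bounded weight. -/
theorem tendsto_integral_mul_of_tendsto_integral_abs_sub {f : ℕ → Ω → ℝ} {g Z : Ω → ℝ} {D : ℝ}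
    (hf : ∀ n, Integrable (f n) P) (hg : Integrable g P) (hZ : Measurable Z) (hD : ∀ ω, |Z ω| ≤ D)
    (h : Tendsto (fun n => ∫ ω, |f n ω - g ω| ∂P) atTop (𝓝 0)) :
    Tendsto (fun n => ∫ ω, Z ω * f n ω ∂P) atTop (𝓝 (∫ ω, Z ω * g ω ∂P)) := by
  rw [tendsto_iff_norm_sub_tendsto_zero]
  refine squeeze_zero (fun _ => norm_nonneg _) (fun n => ?_) (by simpa using h.const_mul D)
  rw [← integral_sub ((hf n).bdd_mul hZ.aestronglyMeasurable (ae_of_all _ hD))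
    (hg.bdd_mul hZ.aestronglyMeasurable (ae_of_all _ hD)), ← integral_const_mul]
  refine (norm_integral_le_integral_norm _).trans (integral_mono_of_nonneg
    (ae_of_all _ fun _ => norm_nonneg _) (((hf n).sub hg).abs.const_mul D) (ae_of_all _ fun ω => ?_))
  change |Z ω * f n ω - Z ω * g ω| ≤ D * |f n ω - g ω|
  rw [← mul_sub, abs_mul]
  gcongr
  exact hD ω

end InMeasure

/-! ### Assembling setwise limits in measure into a kernel -/

section Kernel

variable {Ω S : Type*} [MeasurableSpace Ω] [MeasurableSpace S]

theorem abs_integral_le_of_abs_le (μ : Measure S) [IsProbabilityMeasure μ] {f : S → ℝ} {C : ℝ}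
    (hC : ∀ x, |f x| ≤ C) : |∫ x, f x ∂μ| ≤ C := by
  simpa using norm_integral_le_of_norm_le_const (μ := μ) (f := f) (C := C) (ae_of_all _ hC)

theorem integrable_of_abs_le (μ : Measure S) [IsFiniteMeasure μ] {f : S → ℝ} (hf : Measurable f)
    (hb : ∃ C : ℝ, ∀ x, |f x| ≤ C) : Integrable f μ :=
  let ⟨C, hC⟩ := hb
  Integrable.of_bound hf.aestronglyMeasurable C (ae_of_all _ hC)

theorem measurable_integral_kernel (κ : Kernel Ω S) [IsMarkovKernel κ] {f : S → ℝ}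
    (hf : Measurable f) : Measurable fun ω => ∫ x, f x ∂(κ ω) :=
  hf.stronglyMeasurable.integral_kernel.measurable

theorem integrable_integral_kernel (P : Measure Ω) [IsFiniteMeasure P] (κ : Kernel Ω S)
    [IsMarkovKernel κ] {f : S → ℝ} (hf : Measurable f) (hb : ∃ C : ℝ, ∀ x, |f x| ≤ C) :
    Integrable (fun ω => ∫ x, f x ∂(κ ω)) P :=
  let ⟨C, hC⟩ := hb
  integrable_of_abs_le P (measurable_integral_kernel κ hf)
    ⟨C, fun ω => abs_integral_le_of_abs_le (κ ω) hC⟩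

theorem integral_bind_kernel (P : Measure Ω) [IsFiniteMeasure P] (κ : Kernel Ω S)
    [IsMarkovKernel κ] {f : S → ℝ} (hf : Measurable f) (hb : ∃ C : ℝ, ∀ x, |f x| ≤ C) :
    ∫ x, f x ∂(P.bind κ) = ∫ ω, ∫ x, f x ∂(κ ω) ∂P := by
  have h : Integrable f (P.bind κ) := integrable_of_abs_le _ hf hb
  rw [Measure.comp_eq_comp_const_apply] at h ⊢
  simpa using Kernel.integral_comp h

theorem bind_kernel_real (P : Measure Ω) [IsFiniteMeasure P] (κ : Kernel Ω S)
    [IsMarkovKernel κ] {B : Set S} (hB : MeasurableSet B) :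
    (P.bind κ).real B = ∫ ω, (κ ω).real B ∂P := by
  have := integral_bind_kernel P κ (f := B.indicator fun _ => 1) (measurable_const.indicator hB)
    ⟨1, fun x => by by_cases hx : x ∈ B <;> simp [hx]⟩
  simpa [integral_indicator hB] using this

theorem measurable_kernel_real (κ : Kernel Ω S) {B : Set S} (hB : MeasurableSet B) :
    Measurable fun ω => (κ ω).real B :=
  (κ.measurable_coe hB).ennreal_toReal

/-- Markov kernels whose values on each measurable set converge in measure integrate, over any
event, to a finite measure. -/
theorem exists_measure_real_eq_setIntegral {P : Measure Ω} [IsFiniteMeasure P]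
    (α : ℕ → Kernel Ω S) [∀ n, IsMarkovKernel (α n)] (g : Set S → Ω → ℝ)
    (hgm : ∀ B, MeasurableSet B → Measurable (g B))
    (hg : ∀ B, MeasurableSet B →
      TendstoInMeasure P (fun n ω => (α n ω).real B) atTop (g B))
    {H : Set Ω} (hH : MeasurableSet H) :
    ∃ ν : Measure S, IsFiniteMeasure ν ∧
      ∀ B, MeasurableSet B → ν.real B = ∫ ω in H, g B ω ∂P := by
  have hlim : ∀ B, MeasurableSet B →
      Tendsto (fun n => ((P.restrict H).bind (α n)).real B) atTop (𝓝 (∫ ω in H, g B ω ∂P)) := by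
    intro B hB
    have hbd : ∀ n ω, |(α n ω).real B| ≤ 1 := fun n ω => by
      rw [abs_of_nonneg measureReal_nonneg]; exact measureReal_le_one
    have hint : Integrable (g B) P :=
      Integrable.of_bound (hgm B hB).aestronglyMeasurable 1
        (ae_abs_le_of_tendstoInMeasure hbd (hg B hB))
    have h1 := tendsto_integral_mul_of_tendsto_integral_abs_sub (P := P)
      (f := fun n ω => (α n ω).real B) (g := g B) (Z := H.indicator fun _ => 1) (D := 1)
      (fun n => integrable_of_abs_le P (measurable_kernel_real (α n) hB) ⟨1, hbd n⟩) hint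
      (measurable_const.indicator hH) (fun ω => by by_cases hx : ω ∈ H <;> simp [hx])
      (tendsto_integral_abs_sub_of_tendstoInMeasure
        (fun n => measurable_kernel_real (α n) hB) (hgm B hB) hbd (hg B hB))
    have h2 : ∀ u : Ω → ℝ, (fun ω => H.indicator (fun _ => (1 : ℝ)) ω * u ω) = H.indicator u := by
      intro u
      ext ω
      by_cases hω : ω ∈ H <;> simp [hω]
    simpa only [h2, integral_indicator hH, bind_kernel_real _ _ hB] using h1
  obtain ⟨ν, hν, hνB⟩ := exists_measure_tendsto (fun n => (P.restrict H).bind (α n))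
    fun B hB => ⟨_, hlim B hB⟩
  exact ⟨ν, hν, fun B hB => tendsto_nhds_unique (hνB B hB) (hlim B hB)⟩

/-- The rational distribution function of a limit in measure of random probability measures on `ℝ`
is almost surely a distribution function. -/
theorem ae_isRatStieltjesPoint {P : Measure Ω} [IsProbabilityMeasure P]
    (α : ℕ → Kernel Ω ℝ) [∀ n, IsMarkovKernel (α n)] (g : Set ℝ → Ω → ℝ)
    (hgm : ∀ B, MeasurableSet B → Measurable (g B))
    (hg : ∀ B, MeasurableSet B →
      TendstoInMeasure P (fun n ω => (α n ω).real B) atTop (g B)) :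
    ∀ᵐ ω ∂P, IsRatStieltjesPoint (fun ω (q : ℚ) => g (Set.Iic (q : ℝ)) ω) ω := by
  have hbd : ∀ B n ω, |(α n ω).real B| ≤ 1 := fun B n ω => by
    rw [abs_of_nonneg measureReal_nonneg]; exact measureReal_le_one
  have hint : ∀ B, MeasurableSet B → Integrable (g B) P := fun B hB =>
    Integrable.of_bound (hgm B hB).aestronglyMeasurable 1
      (ae_abs_le_of_tendstoInMeasure (hbd B) (hg B hB))
  -- Each `g B` is determined only up to a null set depending on `B`, so countable additivity is
  -- available only for the mean `ν`. For monotone sequences with a pointwise bound, convergence of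
  -- the means to the mean of the bound forces almost sure convergence.
  obtain ⟨ν, hν, hνB⟩ := exists_measure_real_eq_setIntegral α g hgm hg MeasurableSet.univ
  simp only [setIntegral_univ] at hνB
  have hν1 : ν.real Set.univ = 1 := by
    rw [hνB _ .univ]
    have h1 : g Set.univ =ᵐ[P] fun _ => 1 := tendstoInMeasure_ae_unique (hg _ .univ) (by
      simpa using tendstoInMeasure_const P 1)
    rw [integral_congr_ae h1]; simp
  have hm : ∀ q : ℚ, MeasurableSet (Set.Iic (q : ℝ)) := fun q => measurableSet_Iic
  have hmono : ∀ᵐ ω ∂P, Monotone fun q : ℚ => g (Set.Iic (q : ℝ)) ω := by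
    have h : ∀ᵐ ω ∂P, ∀ p : ℚ × ℚ, p.1 ≤ p.2 →
        g (Set.Iic (p.1 : ℝ)) ω ≤ g (Set.Iic (p.2 : ℝ)) ω := by
      rw [ae_all_iff]
      intro p
      by_cases hp : p.1 ≤ p.2
      · filter_upwards [ae_le_of_tendstoInMeasure
          (fun n ω => measureReal_mono (μ := α n ω)
            (Set.Iic_subset_Iic.2 (Rat.cast_le.2 hp : (p.1 : ℝ) ≤ p.2)))
          (hg _ (hm p.1)) (hg _ (hm p.2))] with ω hω _ using hω
      · exact ae_of_all _ fun ω h => absurd h hp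
    filter_upwards [h] with ω hω p q hpq using hω (p, q) hpq
  have hbound : ∀ᵐ ω ∂P, ∀ q : ℚ, 0 ≤ g (Set.Iic (q : ℝ)) ω ∧ g (Set.Iic (q : ℝ)) ω ≤ 1 := by
    rw [ae_all_iff]
    intro q
    filter_upwards [ae_le_of_tendstoInMeasure (fun _ _ => measureReal_nonneg) (tendstoInMeasure_const P 0)
      (hg _ (hm q)), ae_le_of_tendstoInMeasure (fun _ _ => measureReal_le_one)
      (hg _ (hm q)) (tendstoInMeasure_const P 1)] with ω h1 h2 using ⟨h1, h2⟩
  have htop : ∀ᵐ ω ∂P,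
      Tendsto (fun n : ℕ => g (Set.Iic ((n : ℚ) : ℝ)) ω) atTop (𝓝 1) := by
    refine tendsto_of_integral_tendsto_of_monotone (F := fun _ => 1) (fun n => hint _ (hm _))
      (integrable_const _) ?_ ?_ ?_
    · simp_rw [← hνB _ (hm _)]
      rw [integral_const, probReal_univ, one_smul, ← hν1]
      simp only [Rat.cast_natCast]
      refine (ENNReal.tendsto_toReal (measure_ne_top ν _)).comp ?_
      have hU : ⋃ n : ℕ, Set.Iic (n : ℝ) = Set.univ :=
        Set.iUnion_eq_univ_iff.2 fun x => exists_nat_ge x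
      rw [← hU]
      exact tendsto_measure_iUnion_atTop fun a b hab => Set.Iic_subset_Iic.2 (by exact_mod_cast hab)
    · filter_upwards [hmono] with ω hω a b hab using hω (by exact_mod_cast hab)
    · filter_upwards [hbound] with ω hω n using (hω _).2
  have hbot : ∀ᵐ ω ∂P,
      Tendsto (fun n : ℕ => g (Set.Iic ((-n : ℚ) : ℝ)) ω) atTop (𝓝 0) := by
    refine tendsto_of_integral_tendsto_of_antitone (F := fun _ => 0) (fun n => hint _ (hm _))
      (integrable_const _) ?_ ?_ ?_
    · simp_rw [← hνB _ (hm _)]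
      have hU : ⋂ n : ℕ, Set.Iic (((-n : ℚ) : ℝ)) = ∅ := by
        refine Set.eq_empty_of_forall_notMem fun x hx => ?_
        obtain ⟨n, hn⟩ := exists_nat_gt (-x)
        have := Set.mem_iInter.1 hx n
        simp only [Set.mem_Iic, Rat.cast_neg, Rat.cast_natCast] at this
        linarith
      have h := tendsto_measure_iInter_atTop (μ := ν)
        (s := fun n : ℕ => Set.Iic (((-n : ℚ) : ℝ))) (fun n => (hm _).nullMeasurableSet)
        (fun a b hab => Set.Iic_subset_Iic.2 (by simpa using hab)) ⟨0, measure_ne_top _ _⟩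
      rw [hU, measure_empty] at h
      rw [integral_zero]
      exact (ENNReal.tendsto_toReal ENNReal.zero_ne_top).comp h
    · filter_upwards [hmono] with ω hω a b hab using hω (by simpa using hab)
    · filter_upwards [hbound] with ω hω n using (hω _).1
  have hright : ∀ᵐ ω ∂P, ∀ t : ℚ,
      Tendsto (fun n : ℕ => g (Set.Iic ((t + 1 / ((n : ℚ) + 1) : ℚ) : ℝ)) ω) atTop
        (𝓝 (g (Set.Iic (t : ℝ)) ω)) := by
    rw [ae_all_iff]
    intro t
    have hanti : Antitone fun n : ℕ => t + 1 / ((n : ℚ) + 1) := fun a b hab => by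
      have : (a : ℚ) ≤ b := by exact_mod_cast hab
      dsimp only; gcongr
    refine tendsto_of_integral_tendsto_of_antitone (fun n => hint _ (hm _)) (hint _ (hm _)) ?_ ?_ ?_
    · simp_rw [← hνB _ (hm _)]
      have hU : ⋂ n : ℕ, Set.Iic ((t + 1 / ((n : ℚ) + 1) : ℚ) : ℝ) = Set.Iic (t : ℝ) := by
        ext x
        simp only [Set.mem_iInter, Set.mem_Iic]
        refine ⟨fun hx => ?_, fun hx n => hx.trans (Rat.cast_le.2 (by
          have : (0 : ℚ) ≤ 1 / ((n : ℚ) + 1) := by positivity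
          linarith))⟩
        have h1 : Tendsto (fun n : ℕ => (t : ℝ) + 1 / ((n : ℝ) + 1)) atTop (𝓝 ((t : ℝ) + 0)) :=
          tendsto_const_nhds.add tendsto_one_div_add_atTop_nhds_zero_nat
        rw [add_zero] at h1
        exact ge_of_tendsto' h1 fun n => by simpa using hx n
      have h := tendsto_measure_iInter_atTop (μ := ν)
        (s := fun n : ℕ => Set.Iic ((t + 1 / ((n : ℚ) + 1) : ℚ) : ℝ))
        (fun n => (hm _).nullMeasurableSet)
        (fun a b hab => Set.Iic_subset_Iic.2 (Rat.cast_le.2 (hanti hab))) ⟨0, measure_ne_top _ _⟩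
      rw [hU] at h
      exact (ENNReal.tendsto_toReal (measure_ne_top ν _)).comp h
    · filter_upwards [hmono] with ω hω a b hab using hω (hanti hab)
    · filter_upwards [hmono] with ω hω n
      refine hω ?_
      have : (0 : ℚ) ≤ 1 / ((n : ℚ) + 1) := by positivity
      linarith
  filter_upwards [hmono, hbound, htop, hbot, hright] with ω hmω hbω htω hoω hrω
  refine ⟨hmω, ?_, ?_, fun t => ?_⟩
  · rw [Metric.tendsto_atTop]
    intro ε hε
    obtain ⟨n, hn⟩ := (htω.eventually (lt_mem_nhds (show 1 - ε < 1 by linarith))).exists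
    refine ⟨n, fun q hq => ?_⟩
    rw [Real.dist_eq, abs_lt]
    constructor <;> linarith [hmω hq, (hbω q).2]
  · rw [tendsto_order]
    refine ⟨fun a ha => Eventually.of_forall fun q => ha.trans_le (hbω q).1, fun a ha => ?_⟩
    obtain ⟨n, hn⟩ := (hoω.eventually (gt_mem_nhds ha)).exists
    filter_upwards [eventually_le_atBot (-n : ℚ)] with q hq
    exact (hmω hq).trans_lt hn
  · refine le_antisymm ?_ (le_ciInf fun r => hmω (le_of_lt r.2))
    refine ge_of_tendsto' (hrω t) fun n => ?_
    exact ciInf_le (f := fun r : Set.Ioi t => g (Set.Iic ((r : ℚ) : ℝ)) ω)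
      ⟨0, by rintro _ ⟨r, rfl⟩; exact (hbω _).1⟩
      ⟨t + 1 / ((n : ℚ) + 1), by
        have : (0 : ℚ) < 1 / ((n : ℚ) + 1) := by positivity
        simp only [Set.mem_Ioi]; linarith⟩

/-- The kernel is read off the limits on the rational half-lines. To reach a general `B`, integrate
over an arbitrary event `H`: by Nikodym's theorem both candidates become finite measures in `B`, and
these agree on the π-system of rational half-lines and on the whole line. -/
theorem exists_kernel_tendstoInMeasure_real {P : Measure Ω} [IsProbabilityMeasure P]
    (α : ℕ → Kernel Ω ℝ) [∀ n, IsMarkovKernel (α n)]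
    (h : ∀ B, MeasurableSet B → ∃ g : Ω → ℝ, Measurable g ∧
      TendstoInMeasure P (fun n ω => (α n ω).real B) atTop g) :
    ∃ κ : Kernel Ω ℝ, IsMarkovKernel κ ∧ ∀ B, MeasurableSet B →
      TendstoInMeasure P (fun n ω => (α n ω).real B) atTop fun ω => (κ ω).real B := by
  classical
  let g : Set ℝ → Ω → ℝ := fun B => if hB : MeasurableSet B then (h B hB).choose else 0
  have hgm : ∀ B, MeasurableSet B → Measurable (g B) := by
    intro B hB
    simp only [g, dif_pos hB]
    exact (h B hB).choose_spec.1
  have hg : ∀ B, MeasurableSet B →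
      TendstoInMeasure P (fun n ω => (α n ω).real B) atTop (g B) := by
    intro B hB
    simp only [g, dif_pos hB]
    exact (h B hB).choose_spec.2
  have hF : Measurable fun ω (q : ℚ) => g (Set.Iic (q : ℝ)) ω :=
    measurable_pi_lambda _ fun q => hgm _ measurableSet_Iic
  let κ : Kernel Ω ℝ :=
    ⟨fun ω => (stieltjesOfMeasurableRat _ hF ω).measure, measurable_measure_stieltjesOfMeasurableRat hF⟩
  have hκ : IsMarkovKernel κ :=
    ⟨fun ω => ⟨measure_stieltjesOfMeasurableRat_univ hF ω⟩⟩
  have hκq : ∀ᵐ ω ∂P, ∀ q : ℚ, (κ ω).real (Set.Iic (q : ℝ)) = g (Set.Iic (q : ℝ)) ω := by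
    filter_upwards [ae_isRatStieltjesPoint α g hgm hg] with ω hω q
    have h1 : stieltjesOfMeasurableRat _ hF ω q = g (Set.Iic (q : ℝ)) ω := by
      rw [stieltjesOfMeasurableRat_eq, toRatCDF_of_isRatStieltjesPoint hω]
    change ((stieltjesOfMeasurableRat _ hF ω).measure (Set.Iic (q : ℝ))).toReal = _
    rw [measure_stieltjesOfMeasurableRat_Iic,
      ENNReal.toReal_ofReal (stieltjesOfMeasurableRat_nonneg hF ω _), h1]
  refine ⟨κ, hκ, fun B hB => (hg B hB).congr_right ?_⟩
  have hint : Integrable (g B) P :=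
    Integrable.of_bound (hgm B hB).aestronglyMeasurable 1
      (ae_abs_le_of_tendstoInMeasure (fun n ω => by
        rw [abs_of_nonneg measureReal_nonneg]; exact measureReal_le_one) (hg B hB))
  have hintκ : Integrable (fun ω => (κ ω).real B) P :=
    integrable_of_abs_le P (measurable_kernel_real κ hB) ⟨1, fun ω => by
      rw [abs_of_nonneg measureReal_nonneg]; exact measureReal_le_one⟩
  refine hint.ae_eq_of_forall_setIntegral_eq _ _ hintκ fun H hH _ => ?_
  obtain ⟨ν, hν, hνB⟩ := exists_measure_real_eq_setIntegral α g hgm hg hH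
  have hg1 : g Set.univ =ᵐ[P] fun _ => 1 := tendstoInMeasure_ae_unique (hg _ .univ) (by
    simpa using tendstoInMeasure_const P 1)
  have heq : ν = (P.restrict H).bind κ := by
    refine ext_of_generate_finite _ Real.borel_eq_generateFrom_Iic_rat Real.isPiSystem_Iic_rat
      ?_ ?_
    · intro s hs
      obtain ⟨q, rfl⟩ : ∃ q : ℚ, Set.Iic (q : ℝ) = s := by simpa using hs
      rw [← measureReal_eq_measureReal_iff, hνB _ measurableSet_Iic,
        bind_kernel_real _ _ measurableSet_Iic]
      refine integral_congr_ae (ae_restrict_of_ae ?_)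
      filter_upwards [hκq] with ω hω using (hω q).symm
    · rw [← measureReal_eq_measureReal_iff, hνB _ .univ, bind_kernel_real _ _ .univ]
      refine integral_congr_ae (ae_restrict_of_ae ?_)
      filter_upwards [hg1] with ω hω using by simp [hω]
  rw [← hνB B hB, heq, bind_kernel_real _ _ hB]

/-- Random probability measures on a standard Borel space whose values on each measurable set
converge in measure have a random probability measure as limit. -/
theorem exists_kernel_tendstoInMeasure [StandardBorelSpace S] [Nonempty S]
    {P : Measure Ω} [IsProbabilityMeasure P]
    (α : ℕ → Kernel Ω S) [∀ n, IsMarkovKernel (α n)]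
    (h : ∀ B, MeasurableSet B → ∃ g : Ω → ℝ, Measurable g ∧
      TendstoInMeasure P (fun n ω => (α n ω).real B) atTop g) :
    ∃ κ : Kernel Ω S, IsMarkovKernel κ ∧ ∀ B, MeasurableSet B →
      TendstoInMeasure P (fun n ω => (α n ω).real B) atTop fun ω => (κ ω).real B := by
  classical
  have he := measurableEmbedding_embeddingReal S
  set e := embeddingReal S
  have hmap : ∀ n ω (B : Set ℝ), MeasurableSet B →
      ((α n).map e ω).real B = (α n ω).real (e ⁻¹' B) := fun n ω B hB => by
    rw [Measure.real, Kernel.map_apply' _ he.measurable _ hB, Measure.real]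
  have : ∀ n, IsMarkovKernel ((α n).map e) := fun n => Kernel.IsMarkovKernel.map _ he.measurable
  obtain ⟨κ, hκ, hκB⟩ := exists_kernel_tendstoInMeasure_real (P := P) (fun n => (α n).map e)
    fun B hB => by
      simp_rw [hmap _ _ B hB]
      exact h _ (he.measurable hB)
  have hR : MeasurableSet {ω | κ ω (Set.range e) = 1} :=
    measurableSet_eq_fun (κ.measurable_coe he.measurableSet_range) measurable_const
  obtain ⟨x₀⟩ := ‹Nonempty S›
  -- The limit on `ℝ` is carried by the range of `e` only almost surely, while pulling back to a
  -- Markov kernel needs this for every `ω`; a Dirac mass in the range is used on the exceptional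
  -- set.
  let κ' : Kernel Ω ℝ := Kernel.piecewise hR κ (Kernel.const Ω (Measure.dirac (e x₀)))
  have hκ' : ∀ ω, κ' ω (Set.range e) = 1 := by
    intro ω
    by_cases hω : κ ω (Set.range e) = 1
    · have : κ' ω = κ ω := by simp [κ', Kernel.piecewise_apply, hω]
      rw [this, hω]
    · have : κ' ω = Measure.dirac (e x₀) := by simp [κ', Kernel.piecewise_apply, hω]
      rw [this, Measure.dirac_apply' _ he.measurableSet_range]
      simp
  have hae : ∀ᵐ ω ∂P, κ' ω = κ ω := by
    have h1 : (fun ω => (κ ω).real (Set.range e)) =ᵐ[P] fun _ => 1 :=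
      tendstoInMeasure_ae_unique (hκB _ he.measurableSet_range) (by
        simp_rw [hmap _ _ _ he.measurableSet_range]
        simpa using tendstoInMeasure_const P 1)
    filter_upwards [h1] with ω hω
    have : κ ω (Set.range e) = 1 := by
      rwa [Measure.real, ENNReal.toReal_eq_one_iff] at hω
    simp [κ', Kernel.piecewise_apply, this]
  refine ⟨κ'.comapRight he, Kernel.IsMarkovKernel.comapRight κ' he hκ', fun B hB => ?_⟩
  have h2 := hκB _ (he.measurableSet_image.2 hB)
  simp_rw [hmap _ _ _ (he.measurableSet_image.2 hB), he.injective.preimage_image] at h2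
  refine h2.congr_right ?_
  filter_upwards [hae] with ω hω
  rw [Measure.real, Measure.real, Kernel.comapRight_apply' _ _ _ hB, hω]

end Kernel

/-! ### Extension to bounded measurable test functions and weights -/

section BoundedMeasurable

variable {Ω S : Type*} [MeasurableSpace Ω] [MeasurableSpace S]

/-- Setwise convergence of probability measures implies convergence of the integrals of bounded
measurable functions. -/
theorem tendsto_integral_of_tendsto_real (μ : ℕ → Measure S) [∀ n, IsProbabilityMeasure (μ n)]
    (ν : Measure S) [IsProbabilityMeasure ν]
    (h : ∀ B, MeasurableSet B → Tendsto (fun n => (μ n).real B) atTop (𝓝 (ν.real B)))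
    {f : S → ℝ} (hf : Measurable f) (hb : ∃ C : ℝ, ∀ x, |f x| ≤ C) :
    Tendsto (fun n => ∫ x, f x ∂(μ n)) atTop (𝓝 (∫ x, f x ∂ν)) := by
  rw [tendsto_iff_norm_sub_tendsto_zero]
  refine tendsto_zero_of_indicator (fun n f => |∫ x, f x ∂(μ n) - ∫ x, f x ∂ν|) 2
    (fun n f => abs_nonneg _) (fun n f g hf hfb hg hgb => ?_) (fun n f ε hf hε => ?_)
    (fun B c hB => ?_) f hf hb
  · dsimp only
    rw [integral_add (integrable_of_abs_le _ hf hfb) (integrable_of_abs_le _ hg hgb),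
      integral_add (integrable_of_abs_le _ hf hfb) (integrable_of_abs_le _ hg hgb),
      add_sub_add_comm]
    exact abs_add_le _ _
  · refine (abs_sub _ _).trans ?_
    linarith [abs_integral_le_of_abs_le (μ n) hε, abs_integral_le_of_abs_le ν hε]
  · simp only [integral_indicator hB, setIntegral_const, smul_eq_mul]
    simpa using (((h B hB).mul_const c).sub_const (ν.real B * c)).abs

/-- `L¹` convergence of Markov kernels on sets implies `L¹` convergence on bounded measurable
functions. -/
theorem tendsto_integral_abs_sub_kernel (P : Measure Ω) [IsProbabilityMeasure P]
    (α : ℕ → Kernel Ω S) [∀ n, IsMarkovKernel (α n)] (κ : Kernel Ω S) [IsMarkovKernel κ]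
    (h : ∀ B, MeasurableSet B →
      Tendsto (fun n => ∫ ω, |(α n ω).real B - (κ ω).real B| ∂P) atTop (𝓝 0))
    {f : S → ℝ} (hf : Measurable f) (hb : ∃ C : ℝ, ∀ x, |f x| ≤ C) :
    Tendsto (fun n => ∫ ω, |∫ x, f x ∂(α n ω) - ∫ x, f x ∂(κ ω)| ∂P) atTop (𝓝 0) := by
  have hint : ∀ n (f : S → ℝ), Measurable f → (∃ C : ℝ, ∀ x, |f x| ≤ C) →
      Integrable (fun ω => |∫ x, f x ∂(α n ω) - ∫ x, f x ∂(κ ω)|) P := fun n f hf hb =>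
    ((integrable_integral_kernel P (α n) hf hb).sub (integrable_integral_kernel P κ hf hb)).abs
  refine tendsto_zero_of_indicator
    (fun n f => ∫ ω, |∫ x, f x ∂(α n ω) - ∫ x, f x ∂(κ ω)| ∂P) 2
    (fun n f => integral_nonneg fun _ => abs_nonneg _) (fun n f g hf hfb hg hgb => ?_)
    (fun n f ε hf hε => ?_) (fun B c hB => ?_) f hf hb
  · dsimp only
    rw [← integral_add (hint n f hf hfb) (hint n g hg hgb)]
    refine integral_mono_of_nonneg (ae_of_all _ fun _ => abs_nonneg _)
      ((hint n f hf hfb).add (hint n g hg hgb)) (ae_of_all _ fun ω => ?_)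
    dsimp only
    rw [integral_add (integrable_of_abs_le _ hf hfb) (integrable_of_abs_le _ hg hgb),
      integral_add (integrable_of_abs_le _ hf hfb) (integrable_of_abs_le _ hg hgb),
      add_sub_add_comm]
    exact abs_add_le _ _
  · refine (integral_mono_of_nonneg (ae_of_all _ fun _ => abs_nonneg _)
      (integrable_const (2 * ε)) (ae_of_all _ fun ω => ?_)).trans (by simp)
    refine (abs_sub _ _).trans ?_
    linarith [abs_integral_le_of_abs_le (α n ω) hε, abs_integral_le_of_abs_le (κ ω) hε]
  · simp only [integral_indicator hB, setIntegral_const, smul_eq_mul, ← sub_mul, abs_mul,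
      integral_mul_const]
    simpa using (h B hB).mul_const |c|

/-- Convergence of the integrals over every event implies convergence against every bounded random
variable. -/
theorem tendsto_integral_mul_of_tendsto_setIntegral (P : Measure Ω) [IsProbabilityMeasure P]
    {Y : ℕ → Ω → ℝ} {V : Ω → ℝ} {C : ℝ} (hY : ∀ n, Measurable (Y n)) (hV : Measurable V)
    (hYC : ∀ n ω, |Y n ω| ≤ C) (hVC : ∀ ω, |V ω| ≤ C)
    (h : ∀ H, MeasurableSet H →
      Tendsto (fun n => ∫ ω in H, Y n ω ∂P) atTop (𝓝 (∫ ω in H, V ω ∂P)))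
    {Z : Ω → ℝ} (hZ : Measurable Z) (hb : ∃ D : ℝ, ∀ ω, |Z ω| ≤ D) :
    Tendsto (fun n => ∫ ω, Z ω * Y n ω ∂P) atTop (𝓝 (∫ ω, Z ω * V ω ∂P)) := by
  have hintmul : ∀ {U Z : Ω → ℝ}, Measurable U → (∀ ω, |U ω| ≤ C) → Measurable Z →
      (∃ D : ℝ, ∀ ω, |Z ω| ≤ D) → Integrable (fun ω => Z ω * U ω) P := by
    rintro U Z hU hUC hZ ⟨D, hD⟩
    exact (integrable_of_abs_le P hU ⟨C, hUC⟩).bdd_mul hZ.aestronglyMeasurable (ae_of_all _ hD)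
  have hmulbd : ∀ {U Z : Ω → ℝ} {ε : ℝ}, (∀ ω, |U ω| ≤ C) → (∀ ω, |Z ω| ≤ ε) →
      |∫ ω, Z ω * U ω ∂P| ≤ ε * C := fun hUC hZ =>
    abs_integral_le_of_abs_le P fun ω => by
      rw [abs_mul]
      exact mul_le_mul (hZ ω) (hUC ω) (abs_nonneg _) ((abs_nonneg _).trans (hZ ω))
  rw [tendsto_iff_norm_sub_tendsto_zero]
  refine tendsto_zero_of_indicator (fun n Z => |∫ ω, Z ω * Y n ω ∂P - ∫ ω, Z ω * V ω ∂P|) (2 * C)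
    (fun n f => abs_nonneg _) (fun n f g hf hfb hg hgb => ?_) (fun n f ε hf hε => ?_)
    (fun B c hB => ?_) Z hZ hb
  · simp only [add_mul]
    rw [integral_add (hintmul (hY n) (hYC n) hf hfb) (hintmul (hY n) (hYC n) hg hgb),
      integral_add (hintmul hV hVC hf hfb) (hintmul hV hVC hg hgb), add_sub_add_comm]
    exact abs_add_le _ _
  · refine (abs_sub _ _).trans ?_
    linarith [hmulbd (hYC n) hε, hmulbd hVC hε]
  · have h2 : ∀ u : Ω → ℝ, ∫ ω, B.indicator (fun _ => c) ω * u ω ∂P = c * ∫ ω in B, u ω ∂P := by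
      intro u
      rw [← integral_const_mul, ← integral_indicator hB]
      congr 1 with ω
      by_cases hω : ω ∈ B <;> simp [hω]
    simp only [h2]
    simpa using (((h B hB).const_mul c).sub_const (c * ∫ ω in B, V ω ∂P)).abs

end BoundedMeasurable

/-! ### Symmetry of conditional expectation -/

section CondExp

variable {Ω : Type*} {m m0 : MeasurableSpace Ω} {P : Measure Ω} [IsProbabilityMeasure P]

/-- The conditional expectation is a symmetric operator. -/
theorem integral_mul_condExp (hm : m ≤ m0) {Z Y : Ω → ℝ} {C : ℝ} (hZ : Integrable Z P)
    (hY : Measurable Y) (hC : ∀ ω, |Y ω| ≤ C) :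
    ∫ ω, Z ω * (P[Y | m]) ω ∂P = ∫ ω, (P[Z | m]) ω * Y ω ∂P := by
  have hYint : Integrable Y P := Integrable.of_bound hY.aestronglyMeasurable C (ae_of_all _ hC)
  have hYb : ∀ᵐ ω ∂P, |(P[Y | m]) ω| ≤ C :=
    ae_bdd_abs_condExp_of_ae_bdd_abs (ae_of_all _ hC)
  have h1 : Integrable (Z * P[Y | m]) P :=
    hZ.mul_bdd integrable_condExp.aestronglyMeasurable hYb
  have h2 : Integrable (P[Z | m] * Y) P :=
    integrable_condExp.mul_bdd hY.aestronglyMeasurable (ae_of_all _ hC)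
  have e1 := condExp_mul_of_stronglyMeasurable_right stronglyMeasurable_condExp h1 hZ
  have e2 := condExp_mul_of_stronglyMeasurable_left stronglyMeasurable_condExp h2 hYint
  calc ∫ ω, Z ω * (P[Y | m]) ω ∂P = ∫ ω, (P[Z * P[Y | m] | m]) ω ∂P := (integral_condExp hm).symm
    _ = ∫ ω, (P[P[Z | m] * Y | m]) ω ∂P := integral_congr_ae (e1.trans e2.symm)
    _ = ∫ ω, (P[Z | m]) ω * Y ω ∂P := integral_condExp hm

end CondExp

/-! ### Predictive kernels and the filtration of the past -/

section Predictive

variable {Ω : Type u} {S : Type v} [MeasurableSpace Ω] [MeasurableSpace S]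

theorem measurable_past {X : ℕ → Ω → S} (hX : ∀ n, Measurable (X n)) (n : ℕ) :
    Measurable (past X n) :=
  measurable_pi_lambda _ fun i => hX i

/-- The predictive distribution as a Markov kernel. -/
def predictiveKernel [StandardBorelSpace S] [Nonempty S] (P : Measure Ω) [IsProbabilityMeasure P]
    (X : ℕ → Ω → S) (hX : ∀ n, Measurable (X n)) (n : ℕ) : Kernel Ω S :=
  (condDistrib (X n) (past X n) P).comap (past X n) (measurable_past hX n)

instance [StandardBorelSpace S] [Nonempty S] (P : Measure Ω) [IsProbabilityMeasure P]
    (X : ℕ → Ω → S) (hX : ∀ n, Measurable (X n)) (n : ℕ) :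
    IsMarkovKernel (predictiveKernel P X hX n) := by
  unfold predictiveKernel; infer_instance

/-- The filtration generated by the past of the sequence. -/
def pastFiltration (X : ℕ → Ω → S) (hX : ∀ n, Measurable (X n)) :
    Filtration ℕ (inferInstance : MeasurableSpace Ω) where
  seq n := ⨆ i : Fin n, MeasurableSpace.comap (X i) inferInstance
  mono' _ b hab := iSup_le fun i =>
    le_iSup (fun i : Fin b => MeasurableSpace.comap (X i) inferInstance) (Fin.castLE hab i)
  le' _ := iSup_le fun i => (hX i).comap_le

end Predictive

section Predictive

variable {Ω : Type u} {S : Type v} [MeasurableSpace Ω] [MeasurableSpace S]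

theorem predictiveKernel_ae_eq_condExp [StandardBorelSpace S] [Nonempty S]
    (P : Measure Ω) [IsProbabilityMeasure P] (X : ℕ → Ω → S) (hX : ∀ n, Measurable (X n)) (n : ℕ)
    {f : S → ℝ} (hf : Measurable f) (hb : ∃ C : ℝ, ∀ x, |f x| ≤ C) :
    (fun ω => ∫ x, f x ∂(predictiveKernel P X hX n ω)) =ᵐ[P]
      P[fun ω => f (X n ω) | pastFiltration X hX n] :=
  predictive_ae_eq_condExp P X hX n f hf hb

theorem bind_predictiveKernel [StandardBorelSpace S] [Nonempty S]
    (P : Measure Ω) [IsProbabilityMeasure P] (X : ℕ → Ω → S) (hX : ∀ n, Measurable (X n)) (n : ℕ) :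
    P.bind (predictiveKernel P X hX n) = P.map (X n) := by
  have := Measure.isProbabilityMeasure_map (μ := P) (hX n).aemeasurable
  ext B hB
  have hb : ∃ C : ℝ, ∀ x, |B.indicator (fun _ => (1 : ℝ)) x| ≤ C :=
    ⟨1, fun x => by by_cases hx : x ∈ B <;> simp [hx]⟩
  have hBm : Measurable (B.indicator fun _ => (1 : ℝ)) := measurable_const.indicator hB
  rw [← measureReal_eq_measureReal_iff, ← integral_indicator_one hB, ← integral_indicator_one hB]
  change ∫ x, B.indicator (fun _ => (1 : ℝ)) x ∂_ = ∫ x, B.indicator (fun _ => (1 : ℝ)) x ∂_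
  rw [integral_bind_kernel _ _ hBm hb, integral_map (hX n).aemeasurable hBm.aestronglyMeasurable,
    integral_congr_ae (predictiveKernel_ae_eq_condExp P X hX n hBm hb),
    integral_condExp ((pastFiltration X hX).le n)]

/-- The law of `Xₙ₊₁` and its predictive distribution have the same asymptotic behaviour against
every integrable random variable. -/
theorem tendsto_integral_mul_sub_integral_mul_predictiveKernel [StandardBorelSpace S] [Nonempty S]
    (P : Measure Ω) [IsProbabilityMeasure P] (X : ℕ → Ω → S) (hX : ∀ n, Measurable (X n))
    {f : S → ℝ} (hf : Measurable f) (hb : ∃ C : ℝ, ∀ x, |f x| ≤ C) {Z : Ω → ℝ}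
    (hZ : Integrable Z P) :
    Tendsto (fun n => ∫ ω, Z ω * f (X n ω) ∂P -
      ∫ ω, Z ω * ∫ x, f x ∂(predictiveKernel P X hX n ω) ∂P) atTop (𝓝 0) := by
  have hb' := hb
  obtain ⟨C, hC⟩ := hb
  let F := pastFiltration X hX
  have hle : (⨆ n, F n) ≤ (inferInstance : MeasurableSpace Ω) := iSup_le F.le
  -- `X n` is not part of the past at time `n`; it enters as the last coordinate of the past at time
  -- `n + 1`.
  have hXF : ∀ n, Measurable[⨆ n, F n] (X n) := fun n =>
    measurable_iff_comap_le.2 ((le_iSup (fun i : Fin (n + 1) =>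
      MeasurableSpace.comap (X i) inferInstance) (Fin.last n)).trans (le_iSup F (n + 1)))
  have h1 : ∀ n, ∫ ω, Z ω * f (X n ω) ∂P = ∫ ω, (P[Z | ⨆ n, F n]) ω * f (X n ω) ∂P := by
    intro n
    refine Eq.trans ?_ (integral_mul_condExp hle hZ (hf.comp (hX n)) (fun ω => hC (X n ω)))
    rw [condExp_of_stronglyMeasurable hle (f := fun ω => f (X n ω))
        (hf.comp (hXF n)).stronglyMeasurable
        (integrable_of_abs_le P (hf.comp (hX n)) ⟨C, fun ω => hC (X n ω)⟩)]
  have h2 : ∀ n, ∫ ω, Z ω * ∫ x, f x ∂(predictiveKernel P X hX n ω) ∂P =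
      ∫ ω, (P[Z | F n]) ω * f (X n ω) ∂P := by
    intro n
    refine Eq.trans (integral_congr_ae ?_) (integral_mul_condExp (F.le n) hZ (hf.comp (hX n))
      (fun ω => hC (X n ω)))
    filter_upwards [predictiveKernel_ae_eq_condExp P X hX n hf hb'] with ω hω
    rw [hω]
  have hint : ∀ m n, Integrable (fun ω => (P[Z | m]) ω * f (X n ω)) P := fun m n =>
    integrable_condExp.mul_bdd (hf.comp (hX n)).aestronglyMeasurable
      (ae_of_all _ fun ω => hC (X n ω))
  -- Lévy's upward theorem in `L¹`; the bounded factor `f (X n)` costs only the constant `C`.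
  have hL1 : Tendsto (fun n => ∫ ω, |(P[Z | F n]) ω - (P[Z | ⨆ n, F n]) ω| ∂P) atTop (𝓝 0) := by
    have h := (ENNReal.tendsto_toReal ENNReal.zero_ne_top).comp
      (tendsto_eLpNorm_condExp (μ := P) (ℱ := F) Z)
    refine h.congr fun n => ?_
    rw [Function.comp_apply, eLpNorm_one_eq_lintegral_enorm,
      ← integral_norm_eq_lintegral_enorm (integrable_condExp.sub integrable_condExp).1]
    rfl
  refine squeeze_zero_norm (fun n => ?_) (by simpa using hL1.mul_const C)
  rw [h1, h2, ← integral_sub (hint _ n) (hint _ n), ← integral_mul_const]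
  refine (norm_integral_le_integral_norm _).trans (integral_mono_of_nonneg
    (ae_of_all _ fun _ => norm_nonneg _)
    ((integrable_condExp.sub integrable_condExp).abs.mul_const C) (ae_of_all _ fun ω => ?_))
  change |(P[Z | ⨆ n, F n]) ω * f (X n ω) - (P[Z | F n]) ω * f (X n ω)| ≤ _
  rw [← sub_mul, abs_mul, abs_sub_comm]
  exact mul_le_mul_of_nonneg_left (hC _) (abs_nonneg _)

theorem integral_abs_sub_kernel_le (P : Measure Ω) [IsFiniteMeasure P] (κ : Kernel Ω S)
    [IsMarkovKernel κ] {f g : S → ℝ} (hf : Measurable f) (hfb : ∃ C : ℝ, ∀ x, |f x| ≤ C)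
    (hg : Measurable g) (hgb : ∃ C : ℝ, ∀ x, |g x| ≤ C) :
    ∫ ω, |∫ x, f x ∂(κ ω) - ∫ x, g x ∂(κ ω)| ∂P ≤ ∫ x, |f x - g x| ∂(P.bind κ) := by
  obtain ⟨C, hC⟩ := hfb
  obtain ⟨D, hD⟩ := hgb
  have hb : ∃ C : ℝ, ∀ x, |(|f x - g x|)| ≤ C :=
    ⟨C + D, fun x => by rw [abs_abs]; exact (abs_sub _ _).trans (add_le_add (hC x) (hD x))⟩
  have hm : Measurable fun x => |f x - g x| := (hf.sub hg).abs
  rw [integral_bind_kernel P κ hm hb]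
  refine integral_mono_of_nonneg (ae_of_all _ fun _ => abs_nonneg _)
    (integrable_integral_kernel P κ hm hb) (ae_of_all _ fun ω => ?_)
  dsimp only
  rw [← integral_sub (integrable_of_abs_le _ hf ⟨C, hC⟩) (integrable_of_abs_le _ hg ⟨D, hD⟩)]
  exact norm_integral_le_integral_norm (fun x => f x - g x)

theorem tendsto_integral_abs_of_tendsto_integral_sq (P : Measure Ω) [IsProbabilityMeasure P]
    {u : ℕ → Ω → ℝ} (hu : ∀ n, Measurable (u n)) (hb : ∀ n, ∃ C : ℝ, ∀ ω, |u n ω| ≤ C)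
    (h : Tendsto (fun n => ∫ ω, u n ω ^ 2 ∂P) atTop (𝓝 0)) :
    Tendsto (fun n => ∫ ω, |u n ω| ∂P) atTop (𝓝 0) := by
  rw [tendsto_order]
  refine ⟨fun a ha => Eventually.of_forall fun n =>
    ha.trans_le (integral_nonneg fun _ => abs_nonneg _), fun ε hε => ?_⟩
  filter_upwards [h.eventually (gt_mem_nhds (show 0 < ε ^ 2 by positivity))] with n hn
  obtain ⟨C, hC⟩ := hb n
  have hsq : Integrable (fun ω => u n ω ^ 2) P :=
    integrable_of_abs_le P ((hu n).pow_const 2) ⟨C ^ 2, fun ω => by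
      rw [abs_pow]; exact pow_le_pow_left₀ (abs_nonneg _) (hC ω) 2⟩
  -- Young's inequality, from `(ε - |u|)² ≥ 0`, replaces Cauchy–Schwarz.
  have h1 : ∫ ω, |u n ω| ∂P ≤ ∫ ω, (ε / 2 + u n ω ^ 2 / (2 * ε)) ∂P := by
    refine integral_mono_of_nonneg (ae_of_all _ fun _ => abs_nonneg _)
      ((integrable_const _).add (hsq.div_const _)) (ae_of_all _ fun ω => ?_)
    have : ε / 2 + u n ω ^ 2 / (2 * ε) - |u n ω| = (ε - |u n ω|) ^ 2 / (2 * ε) := by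
      rw [← sq_abs (u n ω)]; field_simp; ring
    have h0 : 0 ≤ (ε - |u n ω|) ^ 2 / (2 * ε) := by positivity
    dsimp only
    linarith
  rw [integral_add (integrable_const _) (hsq.div_const _), integral_const, probReal_univ, one_smul,
    integral_div] at h1
  have h2 : (∫ ω, u n ω ^ 2 ∂P) / (2 * ε) < ε / 2 := by
    rw [div_lt_iff₀ (by positivity)]; nlinarith
  linarith

theorem exists_abs_le_boundedContinuousFunction {S : Type*} [TopologicalSpace S] (f : S →ᵇ ℝ) :
    ∃ C : ℝ, ∀ x, |f x| ≤ C :=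
  ⟨‖f‖, fun x => f.norm_coe_le_norm x⟩

/-- Removes the normalisation by `P H`, so that null events, on which both integrals vanish, need no
separate treatment later. -/
theorem convergesStably_iff [TopologicalSpace S] [OpensMeasurableSpace S]
    (P : Measure Ω) [IsProbabilityMeasure P] (X : ℕ → Ω → S) (hX : ∀ n, Measurable (X n))
    (α : Kernel Ω S) [IsMarkovKernel α] :
    ConvergesStably P X hX α ↔ ∀ (f : S →ᵇ ℝ) (H : Set Ω), MeasurableSet H →
      Tendsto (fun n => ∫ ω in H, f (X n ω) ∂P) atTop (𝓝 (∫ ω in H, ∫ x, f x ∂(α ω) ∂P)) := by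
  have h1 : ∀ (H : Set Ω) (hH : P H ≠ 0) (f : S →ᵇ ℝ) (n : ℕ),
      ∫ x, f x ∂(condLaw P hH (hX n) : Measure S) =
        (P.real H)⁻¹ * ∫ ω in H, f (X n ω) ∂P := by
    intro H hH f n
    change ∫ x, f x ∂(P[|H].map (X n)) = _
    rw [integral_map (hX n).aemeasurable f.continuous.measurable.aestronglyMeasurable,
      ProbabilityTheory.cond, integral_smul_measure, ENNReal.toReal_inv]
    rfl
  have h2 : ∀ (H : Set Ω) (hH : P H ≠ 0) (f : S →ᵇ ℝ),
      ∫ x, f x ∂(condMean P hH α : Measure S) =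
        (P.real H)⁻¹ * ∫ ω in H, ∫ x, f x ∂(α ω) ∂P := by
    intro H hH f
    change ∫ x, f x ∂(P[|H].bind α) = _
    have := cond_isProbabilityMeasure hH
    rw [integral_bind_kernel _ _ f.continuous.measurable
      (exists_abs_le_boundedContinuousFunction f), ProbabilityTheory.cond, integral_smul_measure,
      ENNReal.toReal_inv]
    rfl
  constructor
  · intro h f H hHm
    by_cases hH : P H = 0
    · simp [Measure.restrict_eq_zero.2 hH]
    have := ProbabilityMeasure.tendsto_iff_forall_integral_tendsto.1 (h H hHm hH) f
    simp only [h1, h2] at this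
    have hr : P.real H ≠ 0 := by rwa [ne_eq, measureReal_eq_zero_iff]
    simpa [mul_inv_cancel_left₀ hr] using this.const_mul (P.real H)
  · intro h H hHm hH
    rw [ProbabilityMeasure.tendsto_iff_forall_integral_tendsto]
    intro f
    simp only [h1, h2]
    exact (h f H hHm).const_mul _

/-! ### From stable convergence to convergence of the predictive distributions -/

/-- Stable convergence and convergence of second moments imply `L¹` convergence of the predictive
distributions on bounded continuous functions. -/
theorem tendsto_integral_abs_sub_of_convergesStably [TopologicalSpace S] [OpensMeasurableSpace S]
    [StandardBorelSpace S] [Nonempty S]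
    (P : Measure Ω) [IsProbabilityMeasure P] (X : ℕ → Ω → S) (hX : ∀ n, Measurable (X n))
    (α : Kernel Ω S) [IsMarkovKernel α] (hst : ConvergesStably P X hX α) (f : S →ᵇ ℝ)
    (hsq : Tendsto (fun n => ∫ ω, (∫ x, f x ∂(predictiveKernel P X hX n ω)) ^ 2 ∂P)
      atTop (𝓝 (∫ ω, (∫ x, f x ∂(α ω)) ^ 2 ∂P))) :
    Tendsto (fun n => ∫ ω, |∫ x, f x ∂(predictiveKernel P X hX n ω) - ∫ x, f x ∂(α ω)| ∂P)
      atTop (𝓝 0) := by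
  have hf : Measurable f := f.continuous.measurable
  have hb := exists_abs_le_boundedContinuousFunction f
  have hb' := hb
  obtain ⟨C, hC⟩ := hb'
  have hA : ∀ n, Measurable fun ω => ∫ x, f x ∂(predictiveKernel P X hX n ω) := fun n =>
    measurable_integral_kernel _ hf
  have hV : Measurable fun ω => ∫ x, f x ∂(α ω) := measurable_integral_kernel _ hf
  have hAC : ∀ n ω, |∫ x, f x ∂(predictiveKernel P X hX n ω)| ≤ C := fun n ω =>
    abs_integral_le_of_abs_le _ hC
  have hVC : ∀ ω, |∫ x, f x ∂(α ω)| ≤ C := fun ω => abs_integral_le_of_abs_le _ hC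
  refine tendsto_integral_abs_of_tendsto_integral_sq P (fun n => (hA n).sub hV)
    (fun n => ⟨C + C, fun ω => (abs_sub _ _).trans (add_le_add (hAC n ω) (hVC ω))⟩) ?_
  -- The cross term: stable convergence is tested against the weight `α(f)` itself, and `h2` then
  -- replaces `f (X n)` by its predictive mean.
  have h1 : Tendsto (fun n => ∫ ω, (∫ x, f x ∂(α ω)) * f (X n ω) ∂P) atTop
      (𝓝 (∫ ω, (∫ x, f x ∂(α ω)) * ∫ x, f x ∂(α ω) ∂P)) :=
    tendsto_integral_mul_of_tendsto_setIntegral P (Y := fun n ω => f (X n ω))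
      (V := fun ω => ∫ x, f x ∂(α ω)) (fun n => hf.comp (hX n)) hV
      (fun n ω => hC _) hVC (fun H hH => (convergesStably_iff P X hX α).1 hst f H hH) hV ⟨C, hVC⟩
  have h2 := tendsto_integral_mul_sub_integral_mul_predictiveKernel P X hX hf hb
    (integrable_integral_kernel P α hf hb)
  have h3 : Tendsto (fun n => ∫ ω, (∫ x, f x ∂(α ω)) *
      ∫ x, f x ∂(predictiveKernel P X hX n ω) ∂P) atTop
      (𝓝 (∫ ω, (∫ x, f x ∂(α ω)) ^ 2 ∂P)) := by
    have := h1.sub h2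
    simpa [← sq] using this
  have h4 := (hsq.sub (h3.const_mul 2)).add_const (∫ ω, (∫ x, f x ∂(α ω)) ^ 2 ∂P)
  have hmulint : ∀ {U W : Ω → ℝ}, Measurable U → Measurable W → (∀ ω, |U ω| ≤ C) →
      (∀ ω, |W ω| ≤ C) → Integrable (fun ω => U ω * W ω) P := fun hU hW hUC hWC =>
    (integrable_of_abs_le P hW ⟨C, hWC⟩).bdd_mul hU.aestronglyMeasurable (ae_of_all _ hUC)
  refine (h4.congr fun n => ?_).trans (by ring_nf; exact le_rfl)
  have i1 := hmulint (hA n) (hA n) (hAC n) (hAC n)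
  have i2 := hmulint hV (hA n) hVC (hAC n)
  have i3 := hmulint hV hV hVC hVC
  simp only [sq]
  have i4 : Integrable (fun ω => (∫ x, f x ∂(predictiveKernel P X hX n ω)) *
      (∫ x, f x ∂(predictiveKernel P X hX n ω)) -
      2 * ((∫ x, f x ∂(α ω)) * ∫ x, f x ∂(predictiveKernel P X hX n ω))) P :=
    i1.sub (i2.const_mul 2)
  rw [← integral_const_mul, ← integral_sub i1 (i2.const_mul 2), ← integral_add i4 i3]
  congr 1 with ω
  ring

/-- The limit law of a sequence which converges setwise and weakly. -/
theorem tendsto_real_map_of_convergesStably [TopologicalSpace S]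
    [TopologicalSpace.MetrizableSpace S] [BorelSpace S]
    (P : Measure Ω) [IsProbabilityMeasure P] (X : ℕ → Ω → S) (hX : ∀ n, Measurable (X n))
    (α : Kernel Ω S) [IsMarkovKernel α] (hst : ConvergesStably P X hX α)
    (hlim : ∀ B, MeasurableSet B → ∃ l : ℝ, Tendsto (fun n => P.real (X n ⁻¹' B)) atTop (𝓝 l))
    (B : Set S) (hB : MeasurableSet B) :
    Tendsto (fun n => (P.map (X n)).real B) atTop (𝓝 ((P.bind α).real B)) := by
  have hpr : ∀ n, IsProbabilityMeasure (P.map (X n)) := fun n =>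
    Measure.isProbabilityMeasure_map (hX n).aemeasurable
  obtain ⟨ν, hν, hνB⟩ := exists_measure_tendsto (fun n => P.map (X n)) fun B hB => by
    simp only [map_measureReal_apply (hX _) hB]
    exact hlim B hB
  have hν1 : IsProbabilityMeasure ν := by
    have h : ν.real Set.univ = 1 := tendsto_nhds_unique (hνB _ .univ) (by simp)
    exact ⟨by rwa [Measure.real, ENNReal.toReal_eq_one_iff] at h⟩
  let := TopologicalSpace.metrizableSpaceMetric S
  -- The setwise limit and the weak limit (stable convergence on the sure event) integrate bounded
  -- continuous functions alike, which determines a finite measure on a metric space.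
  have heq : ν = P.bind α := by
    refine ext_of_forall_integral_eq_of_IsFiniteMeasure fun f => ?_
    have hb := exists_abs_le_boundedContinuousFunction f
    have hf : Measurable f := f.continuous.measurable
    have h1 := tendsto_integral_of_tendsto_real (fun n => P.map (X n)) ν hνB hf hb
    simp only [integral_map (hX _).aemeasurable hf.aestronglyMeasurable] at h1
    have h2 := (convergesStably_iff P X hX α).1 hst f Set.univ .univ
    simp only [setIntegral_univ] at h2
    rw [integral_bind_kernel _ _ hf hb]
    exact tendsto_nhds_unique h1 h2
  rw [← heq]
  exact hνB B hB

theorem predictiveConverges_of_convergesStably [TopologicalSpace S]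
    [TopologicalSpace.MetrizableSpace S] [BorelSpace S] [StandardBorelSpace S] [Nonempty S]
    (P : Measure Ω) [IsProbabilityMeasure P] (X : ℕ → Ω → S) (hX : ∀ n, Measurable (X n))
    (hlim : ∀ B, MeasurableSet B → ∃ l : ℝ, Tendsto (fun n => P.real (X n ⁻¹' B)) atTop (𝓝 l))
    (α : Kernel Ω S) [IsMarkovKernel α] (hst : ConvergesStably P X hX α)
    (hsq : ∀ f : S →ᵇ ℝ,
      Tendsto (fun n => ∫ ω, (∫ x, f x ∂(predictiveKernel P X hX n ω)) ^ 2 ∂P)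
        atTop (𝓝 (∫ ω, (∫ x, f x ∂(α ω)) ^ 2 ∂P))) :
    PredictiveConverges P X := by
  intro f hf hb
  have hpr : ∀ n, IsProbabilityMeasure (P.map (X n)) := fun n =>
    Measure.isProbabilityMeasure_map (hX n).aemeasurable
  refine ⟨fun ω => ∫ x, f x ∂(α ω), measurable_integral_kernel α hf,
    tendstoInMeasure_of_tendsto_integral_abs_sub
      (fun n => integrable_integral_kernel P (predictiveKernel P X hX n) hf hb)
      (integrable_integral_kernel P α hf hb) ?_⟩
  change Tendsto (fun n => ∫ ω, |∫ x, f x ∂(predictiveKernel P X hX n ω) - ∫ x, f x ∂(α ω)| ∂P)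
      atTop (𝓝 0)
  rw [tendsto_order]
  refine ⟨fun a ha => Eventually.of_forall fun n =>
    ha.trans_le (integral_nonneg fun _ => abs_nonneg _), fun ε hε => ?_⟩
  let := TopologicalSpace.metrizableSpaceMetric S
  -- Replacing `f` by `g` costs at most `ε / 4` under `α` and, for large `n`, less than `ε / 2`
  -- under the predictive kernel; the convergence for `g` takes the remaining `ε / 4`.
  obtain ⟨g, hg, -⟩ := (integrable_of_abs_le (P.bind α) hf hb).exists_boundedContinuous_integral_sub_le
    (show 0 < ε / 4 by positivity)
  simp only [Real.norm_eq_abs] at hg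
  have hgb := exists_abs_le_boundedContinuousFunction g
  have hgm : Measurable g := g.continuous.measurable
  have hfg : ∃ C : ℝ, ∀ x, |(|f x - g x|)| ≤ C := by
    obtain ⟨C, hC⟩ := hb
    obtain ⟨D, hD⟩ := hgb
    exact ⟨C + D, fun x => by rw [abs_abs]; exact (abs_sub _ _).trans (add_le_add (hC x) (hD x))⟩
  have h1 := tendsto_integral_of_tendsto_real (fun n => P.map (X n)) (P.bind α)
    (tendsto_real_map_of_convergesStably P X hX α hst hlim) (f := fun x => |f x - g x|)
    (hf.sub hgm).abs hfg
  have h2 := tendsto_integral_abs_sub_of_convergesStably P X hX α hst g (hsq g)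
  filter_upwards [h1.eventually (gt_mem_nhds (show _ < ε / 2 by linarith)),
    h2.eventually (gt_mem_nhds (show 0 < ε / 4 by positivity))] with n hn1 hn2
  have h3 := integral_abs_sub_kernel_le P (predictiveKernel P X hX n) hf hb hgm hgb
  rw [bind_predictiveKernel] at h3
  have h4 := integral_abs_sub_kernel_le P α hf hb hgm hgb
  have j1 := integrable_integral_kernel P (predictiveKernel P X hX n) hf hb
  have j2 := integrable_integral_kernel P (predictiveKernel P X hX n) hgm hgb
  have j3 := integrable_integral_kernel P α hf hb
  have j4 := integrable_integral_kernel P α hgm hgb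
  have h5 : ∫ ω, |∫ x, f x ∂(predictiveKernel P X hX n ω) - ∫ x, f x ∂(α ω)| ∂P ≤
      ∫ ω, (|∫ x, f x ∂(predictiveKernel P X hX n ω) - ∫ x, g x ∂(predictiveKernel P X hX n ω)| +
        |∫ x, g x ∂(predictiveKernel P X hX n ω) - ∫ x, g x ∂(α ω)| +
        |∫ x, f x ∂(α ω) - ∫ x, g x ∂(α ω)|) ∂P := by
    refine integral_mono_of_nonneg (ae_of_all _ fun _ => abs_nonneg _)
      (((j1.sub j2).abs.add (j2.sub j4).abs).add (j3.sub j4).abs) (ae_of_all _ fun ω => ?_)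
    dsimp only
    rw [abs_sub_comm (∫ x, f x ∂(α ω))]
    exact (abs_sub_le _ (∫ x, g x ∂(α ω)) _).trans (add_le_add_left (abs_sub_le _ _ _) _)
  have k : Integrable (fun ω =>
      |∫ x, f x ∂(predictiveKernel P X hX n ω) - ∫ x, g x ∂(predictiveKernel P X hX n ω)| +
        |∫ x, g x ∂(predictiveKernel P X hX n ω) - ∫ x, g x ∂(α ω)|) P :=
    (j1.sub j2).abs.add (j2.sub j4).abs
  rw [integral_add k (by exact (j3.sub j4).abs),
    integral_add (by exact (j1.sub j2).abs) (by exact (j2.sub j4).abs)] at h5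
  linarith

/-! ### From convergence of the predictive distributions to stable convergence -/

theorem exists_kernel_of_predictiveConverges [TopologicalSpace S] [OpensMeasurableSpace S]
    [StandardBorelSpace S] [Nonempty S]
    (P : Measure Ω) [IsProbabilityMeasure P] (X : ℕ → Ω → S) (hX : ∀ n, Measurable (X n))
    (h : PredictiveConverges P X) :
    (∀ B : Set S, MeasurableSet B →
      ∃ l : ℝ, Tendsto (fun n => P.real (X n ⁻¹' B)) atTop (𝓝 l)) ∧
    ∃ (α : Kernel Ω S) (_ : IsMarkovKernel α), ConvergesStably P X hX α ∧ ∀ f : S →ᵇ ℝ,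
      Tendsto (fun n => ∫ ω, (∫ x, f x ∂(predictiveKernel P X hX n ω)) ^ 2 ∂P)
        atTop (𝓝 (∫ ω, (∫ x, f x ∂(α ω)) ^ 2 ∂P)) := by
  have hbd : ∀ (κ : Kernel Ω S) [IsMarkovKernel κ] (B : Set S) ω, |(κ ω).real B| ≤ 1 :=
    fun κ _ B ω => by rw [abs_of_nonneg measureReal_nonneg]; exact measureReal_le_one
  -- The hypothesis is used for indicators only; the `L¹` extension below recovers every bounded
  -- continuous function with the single limit `α`.
  obtain ⟨α, hα, hαB⟩ := exists_kernel_tendstoInMeasure (P := P) (predictiveKernel P X hX)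
    fun B hB => by
      obtain ⟨g, hgm, hg⟩ := h (B.indicator fun _ => 1) (measurable_const.indicator hB)
        ⟨1, fun x => by by_cases hx : x ∈ B <;> simp [hx]⟩
      refine ⟨g, hgm, ?_⟩
      simp only [integral_indicator hB, setIntegral_const, smul_eq_mul, mul_one] at hg
      exact hg
  have hL1 : ∀ B, MeasurableSet B →
      Tendsto (fun n => ∫ ω, |(predictiveKernel P X hX n ω).real B - (α ω).real B| ∂P) atTop
        (𝓝 0) := fun B hB =>
    tendsto_integral_abs_sub_of_tendstoInMeasure (fun n => measurable_kernel_real _ hB)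
      (measurable_kernel_real _ hB) (fun n ω => hbd _ B ω) (hαB B hB)
  have hL1f : ∀ f : S →ᵇ ℝ, Tendsto (fun n => ∫ ω, |∫ x, f x ∂(predictiveKernel P X hX n ω) -
      ∫ x, f x ∂(α ω)| ∂P) atTop (𝓝 0) := fun f =>
    tendsto_integral_abs_sub_kernel P _ α hL1 f.continuous.measurable
      (exists_abs_le_boundedContinuousFunction f)
  refine ⟨fun B hB => ⟨∫ ω, (α ω).real B ∂P, ?_⟩, α, hα, ?_, fun f => ?_⟩
  · have h1 := tendsto_integral_mul_of_tendsto_integral_abs_sub (Z := fun _ => 1) (D := 1)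
      (fun n => integrable_of_abs_le P (measurable_kernel_real _ hB) ⟨1, hbd _ B⟩)
      (integrable_of_abs_le P (measurable_kernel_real α hB) ⟨1, hbd _ B⟩) measurable_const
      (by simp) (hL1 B hB)
    simpa only [one_mul, ← bind_kernel_real P _ hB, bind_predictiveKernel,
      map_measureReal_apply (hX _) hB] using h1
  · rw [convergesStably_iff]
    intro f H hH
    have hf : Measurable f := f.continuous.measurable
    have hb := exists_abs_le_boundedContinuousFunction f
    have hZ : Measurable (H.indicator fun _ => (1 : ℝ)) := measurable_const.indicator hH
    have hZ1 : ∀ ω, |H.indicator (fun _ => (1 : ℝ)) ω| ≤ 1 := fun ω => by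
      by_cases hx : ω ∈ H <;> simp [hx]
    have h1 := tendsto_integral_mul_of_tendsto_integral_abs_sub
      (fun n => integrable_integral_kernel P (predictiveKernel P X hX n) hf hb)
      (integrable_integral_kernel P α hf hb) hZ hZ1 (hL1f f)
    have h2 := tendsto_integral_mul_sub_integral_mul_predictiveKernel P X hX hf hb
      (integrable_of_abs_le P hZ ⟨1, hZ1⟩)
    -- On each event the Lévy step exchanges `f (X n)` for its predictive mean, whose limit is known
    -- from `h1`.
    have h3 := h2.add h1
    have h4 : ∀ u : Ω → ℝ, (fun ω => H.indicator (fun _ => (1 : ℝ)) ω * u ω) = H.indicator u := by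
      intro u
      ext ω
      by_cases hω : ω ∈ H <;> simp [hω]
    simpa only [sub_add_cancel, zero_add, h4, integral_indicator hH] using h3
  · have hf : Measurable f := f.continuous.measurable
    have hb := exists_abs_le_boundedContinuousFunction f
    have hb' := hb
    obtain ⟨C, hC⟩ := hb'
    have hA : ∀ (κ : Kernel Ω S) [IsMarkovKernel κ],
        Integrable (fun ω => (∫ x, f x ∂(κ ω)) ^ 2) P := fun κ _ =>
      integrable_of_abs_le P ((measurable_integral_kernel κ hf).pow_const 2) ⟨C ^ 2, fun ω => by
        rw [abs_pow]
        exact pow_le_pow_left₀ (abs_nonneg _) (abs_integral_le_of_abs_le _ hC) 2⟩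
    -- Since `|a² - b²| ≤ 2C |a - b|` when `|a|, |b| ≤ C`, the second moments inherit the `L¹`
    -- convergence.
    rw [tendsto_iff_norm_sub_tendsto_zero]
    refine squeeze_zero (fun _ => norm_nonneg _) (fun n => ?_)
      (by simpa using (hL1f f).const_mul (C + C))
    rw [← integral_sub (hA _) (hA _), ← integral_const_mul]
    refine (norm_integral_le_integral_norm _).trans (integral_mono_of_nonneg
      (ae_of_all _ fun _ => norm_nonneg _)
      (((integrable_integral_kernel P (predictiveKernel P X hX n) hf hb).sub
        (integrable_integral_kernel P α hf hb)).abs.const_mul (C + C)) (ae_of_all _ fun ω => ?_))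
    dsimp only
    rw [Real.norm_eq_abs, sq_sub_sq, abs_mul]
    refine mul_le_mul_of_nonneg_right ?_ (abs_nonneg _)
    exact (abs_add_le _ _).trans
      (add_le_add (abs_integral_le_of_abs_le _ hC) (abs_integral_le_of_abs_le _ hC))

end Predictive

end

end PredictiveConvergence

theorem mainTheorem1 {Ω : Type*} {S : Type*} [MeasurableSpace Ω]
    [TopologicalSpace S] [TopologicalSpace.MetrizableSpace S] [SecondCountableTopology S]
    [MeasurableSpace S] [BorelSpace S] [StandardBorelSpace S] [Nonempty S]
    (P : Measure Ω) [IsProbabilityMeasure P]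
    (X : ℕ → Ω → S) (hX : ∀ n, Measurable (X n)) :
    PredictiveConvergence.PredictiveConverges P X ↔
      (∀ B : Set S, MeasurableSet B →
        ∃ l : ℝ, Tendsto (fun n => P.real (X n ⁻¹' B)) atTop (𝓝 l)) ∧
      ∃ (α : Kernel Ω S) (_ : IsMarkovKernel α),
        PredictiveConvergence.ConvergesStably P X hX α ∧
        ∀ f : S →ᵇ ℝ,
          Tendsto (fun n => ∫ ω, (∫ x, f x ∂(PredictiveConvergence.predictive P X n ω)) ^ 2 ∂P)
            atTop (𝓝 (∫ ω, (∫ x, f x ∂(α ω)) ^ 2 ∂P)) := by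
  constructor
  · exact PredictiveConvergence.exists_kernel_of_predictiveConverges P X hX
  · rintro ⟨hlim, α, hα, hst, hsq⟩
    exact PredictiveConvergence.predictiveConverges_of_convergesStably P X hX hlim α hst hsq
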